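/- \textbf{Setting.} Alice has a broadcast channel consisting of two independent memoryless binary erasure channels, $\mathrm{BEC}(p_1)$ to Bob-1 and $\mathrm{BEC}(p_2)$ to Bob-2 ($0\le p_1,p_2\le 1$), and a noiseless public channel. Strings $M_{i0},M_{i1}\in\{0,1\}^{k_i}$ (Alice) and choice bits $Z_i\in\{0,1\}$ (Bob-$i$), $i\in\{1,2\}$, are uniform and, together with all local randomness and all erasures, mutually independent. Write $\overline{z}=1-z$ for bits, $\overline{1}=2$, $\overline{2}=1$ for receivers. The real parameters satisfy $0<\lambda<1$, $0<\lambda'<r_i$ and $r_i<p_{\overline i}\min\{p_i,1-p_i\}-\lambda$ for $i=1,2$. For $n$ channel uses put $k_i=\lfloor n(r_i-\lambda')\rfloor$, $\ell_1=\lfloor \frac{r_1}{p_2-\lambda'}n\rfloor$, $\ell_2=\lfloor r_2n\rfloor$, and $s=\lfloor (p_1-\lambda-\frac{r_1}{p_2-\lambda'})n\rfloor$ if $p_1>\frac12$ and this is positive, $s=0$ otherwise. The receivers are labelled so that Alice serves Bob-1 first. Let $\mathcal K_i$ be any two-universal families of hash functions $\{0,1\}^{\ell_i}\to\{0,1\}^{k_i}$.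 \textbf{Protocol 2.} (1) Alice broadcasts a uniform $X^n\in\{0,1\}^n$; Bob-$i$ receives $Y_i^n\in\{0,1,e\}^n$; let $E_i$ and $\overline{E}_i$ be the sets of its erased and unerased positions. (2) Bob-1 aborts, ending the protocol, unless $|\overline{E}_1|\ge \ell_1$ and $|E_1|\ge \ell_1+s$. Otherwise he draws $S_{Z_1}$ uniformly from the $\ell_1$-subsets of $\overline{E}_1$, $S_{\overline{Z}_1}$ uniformly from the $\ell_1$-subsets of $E_1$, and $S'$ uniformly from the $s$-subsets of $E_1\setminus S_{\overline{Z}_1}$, and publishes $S_0,S_1,S'$. (3) Alice publishes independent uniform $\kappa_{10},\kappa_{11}\in\mathcal K_1$ and $M_{1j}\oplus\kappa_{1j}(X|_{S_j})$, $j=0,1$; from this and $Y_1|_{S_{Z_1}}=X|_{S_{Z_1}}$ Bob-1 computes $\hat M_{1Z_1}$. (4) If $S'\neq\emptyset$, Bob-2, using only the positions in $S'$, aborts unless $|S'\cap E_2|,|S'\cap\overline{E}_2|\ge \ell_2$, and otherwise draws $S'_{Z_2}$ and $S'_{\overline{Z}_2}$ uniformly from the $\ell_2$-subsets of $S'\cap\overline{E}_2$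 and $S'\cap E_2$ and publishes $S'_0,S'_1$. Alice publishes independent uniform $\kappa_{20},\kappa_{21}\in\mathcal K_2$ and $M_{2j}\oplus\kappa_{2j}(X|_{S'_j})$, $j=0,1$, from which Bob-2 computes $\hat M_{2Z_2}$. If a phase is aborted or does not take place, the estimate concerned counts as wrong. Let $\mathbf C$ be the complete public transcript, $U$ Alice's final view (all four strings, her local randomness, $X^n$, $\mathbf C$), and $V_i$ Bob-$i$'s final view ($Z_i$, his local randomness $R_{B_i}$, $Y_i^n$, $\mathbf C$). \textbf{Lemma.} Protocol 2 is correct and secure against colluding honest-but-curious players: \begin{enumerate} \item (Correctness) If $\frac{r_1}{p_2-\lambda'}<\min\{p_1,1-p_1\}$, then $\lim_{n\to\infty}\Pr[\hat M_{1Z_1}\ne M_{1Z_1}]=0$. If moreover $p_1>\frac12$ and $r_2<\bigl(p_1-\lambda-\frac{r_1}{p_2-\lambda'}\bigr)\min\{p_2,1-p_2\}$, then also $\lim_{n\to\infty}\Pr[\hat M_{2Z_2}\neq M_{2Z_2}]=0$. \item $\lim_{n\to\infty} I(M_{1\overline{Z}_1},M_{2\overline{Z}_2};V_1,V_2)=0$.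 \item $I(Z_i;U,V_{\overline i})=0$ for every $n$ and $i\in\{1,2\}$. \item $I(Z_1,Z_2;U)=0$ for every $n$. \item $\lim_{n\to\infty} I(M_{i0},M_{i1},M_{\overline i\,\overline{Z}_{\overline i}},Z_i;V_{\overline i})=0$ for $i\in\{1,2\}$. \end{enumerate} -/

import Mathlib

open Finset Filter Topology

namespace BroadcastOT

/-! ### Finite probability: probabilities and mutual information -/

section Information

variable {Ω : Type*} [Fintype Ω]

open Classical in
/-- Probability of the event `A` under the probability weights `w` on the finite space `Ω`. -/
noncomputable def prob (w : Ω → ℝ) (A : Ω → Prop) : ℝ :=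
  ∑ ω, if A ω then w ω else 0

/-- Mutual information `I(X;Y)` in bits of two random variables on a finite probability space,
as the expectation of `log₂ (P(X = x, Y = y) / (P(X = x) P(Y = y)))`. -/
noncomputable def mutualInfo {α β : Type*} (w : Ω → ℝ) (X : Ω → α) (Y : Ω → β) : ℝ :=
  ∑ ω, w ω * Real.logb 2
    (prob w (fun ω' => X ω' = X ω ∧ Y ω' = Y ω) /
      (prob w (fun ω' => X ω' = X ω) * prob w (fun ω' => Y ω' = Y ω)))

end Information

/-! ### Ingredients -/

/-- Bit strings of length `k`. -/
abbrev Bits (k : ℕ) : Type := Fin k → Bool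

/-- Bitwise exclusive or. -/
def bxor {k : ℕ} (a b : Bits k) : Bits k := fun i => xor (a i) (b i)

/-- A two-universal family of hash functions `{0,1}^m → {0,1}^k`, indexed by a uniform seed:
two distinct inputs collide with probability at most `2⁻ᵏ`. -/
structure TwoUniversalFamily (m k : ℕ) where
  Seed : Type
  [fintypeSeed : Fintype Seed]
  [nonemptySeed : Nonempty Seed]
  hash : Seed → Bits m → Bits k
  two_universal : ∀ x x' : Bits m, x ≠ x' →
    (Nat.card {t : Seed // hash t x = hash t x'} : ℝ) / Fintype.card Seed ≤ (2 : ℝ)⁻¹ ^ k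

attribute [instance] TwoUniversalFamily.fintypeSeed TwoUniversalFamily.nonemptySeed

/-- A way of drawing uniformly random subsets of given size with local randomness: for a uniform
`t : Tape`, the set `pick t E m` is uniform on the `m`-element subsets of `E` (if there are any). -/
structure SubsetSampler (n : ℕ) where
  Tape : Type
  [fintypeTape : Fintype Tape]
  [nonemptyTape : Nonempty Tape]
  pick : Tape → Finset (Fin n) → ℕ → Finset (Fin n)
  uniform : ∀ (E : Finset (Fin n)) (m : ℕ), ∀ A ∈ E.powersetCard m,
    (Nat.card {t : Tape // pick t E m = A} : ℝ) / Fintype.card Tape = 1 / (E.card.choose m : ℝ)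

attribute [instance] SubsetSampler.fintypeTape SubsetSampler.nonemptyTape

/-- The tuple `x|_S`, in increasing order of the indices, of a set `S` of size `m`
(only used for sets of that size). -/
noncomputable def restrict {n : ℕ} (x : Fin n → Bool) (S : Finset (Fin n)) (m : ℕ) : Bits m :=
  fun j => if h : S.card = m then x (S.orderEmbOfFin h j) else false

/-- The set of erased positions of a channel output; `none` is the erasure symbol. -/
def erased {n : ℕ} (y : Fin n → Option Bool) : Finset (Fin n) :=
  univ.filter fun l => y l = none

/-! ### The protocol -/

/-- Real parameters of the protocol. Bob-1 is the receiver whom Alice serves first. -/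
structure Params where
  p₁ : ℝ
  p₂ : ℝ
  r₁ : ℝ
  r₂ : ℝ
  lam : ℝ
  lam' : ℝ

namespace Params

variable (P : Params)

/-- The constraints on the parameters. -/
structure Admissible : Prop where
  p₁_nonneg : 0 ≤ P.p₁
  p₁_le_one : P.p₁ ≤ 1
  p₂_nonneg : 0 ≤ P.p₂
  p₂_le_one : P.p₂ ≤ 1
  lam_pos : 0 < P.lam
  lam_lt_one : P.lam < 1
  r₁_lt : P.r₁ < P.p₂ * min P.p₁ (1 - P.p₁) - P.lam
  r₂_lt : P.r₂ < P.p₁ * min P.p₂ (1 - P.p₂) - P.lam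
  lam'_pos : 0 < P.lam'
  lam'_lt_r₁ : P.lam' < P.r₁
  lam'_lt_r₂ : P.lam' < P.r₂

/-- Length of Bob-1's strings. -/
noncomputable def k₁ (n : ℕ) : ℕ := ⌊n * (P.r₁ - P.lam')⌋₊

/-- Length of Bob-2's strings. -/
noncomputable def k₂ (n : ℕ) : ℕ := ⌊n * (P.r₂ - P.lam')⌋₊

/-- Size of the two index sets of Bob-1. -/
noncomputable def len₁ (n : ℕ) : ℕ := ⌊P.r₁ / (P.p₂ - P.lam') * n⌋₊

/-- Size of the two index sets of Bob-2. -/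
noncomputable def len₂ (n : ℕ) : ℕ := ⌊P.r₂ * n⌋₊

open Classical in
/-- Size of the set `S'` of leftover erasures of Bob-1. -/
noncomputable def lenLeft (n : ℕ) : ℕ :=
  if 1 / 2 < P.p₁ then ⌊(P.p₁ - P.lam - P.r₁ / (P.p₂ - P.lam')) * n⌋₊ else 0

end Params

/-- The tools fixed in advance for `n` channel uses: the hash families, and the way in which
each receiver draws random subsets. -/
structure Tools (P : Params) (n : ℕ) where
  hash₁ : TwoUniversalFamily (P.len₁ n) (P.k₁ n)
  hash₂ : TwoUniversalFamily (P.len₂ n) (P.k₂ n)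
  sampler₁ : SubsetSampler n
  sampler₂ : SubsetSampler n

variable {P : Params} {n : ℕ}

/-- Everything that is random in one execution. -/
structure Outcome (D : Tools P n) where
  /-- the strings `m_{10}, m_{11}` -/
  m₁ : Bool → Bits (P.k₁ n)
  /-- the strings `m_{20}, m_{21}` -/
  m₂ : Bool → Bits (P.k₂ n)
  /-- the choice bits -/
  z₁ : Bool
  z₂ : Bool
  /-- Alice's channel input -/
  x : Fin n → Bool
  /-- the erasure indicators of the two binary erasure channels -/
  e₁ : Fin n → Bool
  e₂ : Fin n → Bool
  /-- the seeds of `κ_{10}, κ_{11}` and `κ_{20}, κ_{21}` -/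
  t₁ : Bool → D.hash₁.Seed
  t₂ : Bool → D.hash₂.Seed
  /-- local randomness of Bob-1 and of Bob-2, one tape for each set to be drawn -/
  rb₁ : Fin 3 → D.sampler₁.Tape
  rb₂ : Fin 2 → D.sampler₂.Tape

/-- There are finitely many outcomes. -/
noncomputable instance Outcome.instFintype (D : Tools P n) : Fintype (Outcome D) :=
  Fintype.ofInjective
    (fun ω : Outcome D => ((ω.m₁, ω.m₂, ω.z₁, ω.z₂), (ω.x, ω.e₁, ω.e₂),
      (ω.t₁, ω.t₂), (ω.rb₁, ω.rb₂))) <| by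
    rintro ⟨⟩ ⟨⟩ h
    simp only [Prod.mk.injEq] at h
    obtain ⟨⟨rfl, rfl, rfl, rfl⟩, ⟨rfl, rfl, rfl⟩, ⟨rfl, rfl⟩, rfl, rfl⟩ := h
    rfl

/-- Bernoulli(`p`) weights. -/
noncomputable def bern (p : ℝ) (b : Bool) : ℝ := if b then p else 1 - p

/-- Weights of the uniform distribution on a finite type. -/
noncomputable def unif {α : Type*} [Fintype α] (_ : α) : ℝ := 1 / Fintype.card α

namespace Outcome

variable {D : Tools P n}

/-- The joint law: all components are independent, the erasures of receiver `i` are i.i.d.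
Bernoulli(`pᵢ`), all other components are uniform. -/
noncomputable def law (ω : Outcome D) : ℝ :=
  unif ω.m₁ * unif ω.m₂ * unif ω.z₁ * unif ω.z₂ * unif ω.x *
    (∏ l, bern P.p₁ (ω.e₁ l)) * (∏ l, bern P.p₂ (ω.e₂ l)) *
    unif ω.t₁ * unif ω.t₂ * unif ω.rb₁ * unif ω.rb₂

/-- What Bob-1 receives from the broadcast of `x`. -/
def y₁ (ω : Outcome D) : Fin n → Option Bool :=
  fun l => if ω.e₁ l then none else some (ω.x l)

/-- What Bob-2 receives from the broadcast of `x`. -/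
def y₂ (ω : Outcome D) : Fin n → Option Bool :=
  fun l => if ω.e₂ l then none else some (ω.x l)

/-- Bob-1's announcement `((S_0, S_1), S')`, or `none` if he aborts because he cannot form these
sets: `S_{z₁}` is drawn from the received positions, the other set from the erased positions,
and `S'` from the remaining erased positions. -/
noncomputable def bob₁ (ω : Outcome D) : Option ((Bool → Finset (Fin n)) × Finset (Fin n)) :=
  let E := erased ω.y₁
  let good := D.sampler₁.pick (ω.rb₁ 0) Eᶜ (P.len₁ n)
  let bad := D.sampler₁.pick (ω.rb₁ 1) E (P.len₁ n)
  let left := D.sampler₁.pick (ω.rb₁ 2) (E \ bad) (P.lenLeft n)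
  if P.len₁ n ≤ Eᶜ.card ∧ P.len₁ n + P.lenLeft n ≤ E.card then
    some (fun j => if j = ω.z₁ then good else bad, left)
  else none

/-- Alice's masked strings `m_{1j} ⊕ κ_{1j}(x|_{S_j})`. -/
noncomputable def mask₁ (ω : Outcome D) (S : Bool → Finset (Fin n)) : Bool → Bits (P.k₁ n) :=
  fun j => bxor (ω.m₁ j) (D.hash₁.hash (ω.t₁ j) (restrict ω.x (S j) (P.len₁ n)))

/-- Public transcript of the first phase: the sets `S_0, S_1`, the set `S'`, the two hash functions
and the two masked strings; `none` if Bob-1 aborts. -/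
noncomputable def c₁ (ω : Outcome D) :
    Option ((Bool → Finset (Fin n)) × Finset (Fin n) × (Bool → D.hash₁.Seed) ×
      (Bool → Bits (P.k₁ n))) :=
  ω.bob₁.map fun s => (s.1, s.2, ω.t₁, ω.mask₁ s.1)

/-- Bob-2's announcement `(S'_0, S'_1)` in the second phase, which uses only the positions in `S'`;
`none` if `S'` is empty (no second phase) or if he aborts because he cannot form the sets. -/
noncomputable def bob₂ (ω : Outcome D) (S' : Finset (Fin n)) : Option (Bool → Finset (Fin n)) :=
  let E := S' ∩ erased ω.y₂
  let G := S' \ erased ω.y₂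
  let good := D.sampler₂.pick (ω.rb₂ 0) G (P.len₂ n)
  let bad := D.sampler₂.pick (ω.rb₂ 1) E (P.len₂ n)
  if S' ≠ ∅ ∧ P.len₂ n ≤ G.card ∧ P.len₂ n ≤ E.card then
    some fun j => if j = ω.z₂ then good else bad
  else none

/-- Alice's masked strings `m_{2j} ⊕ κ_{2j}(x|_{S'_j})`. -/
noncomputable def mask₂ (ω : Outcome D) (S : Bool → Finset (Fin n)) : Bool → Bits (P.k₂ n) :=
  fun j => bxor (ω.m₂ j) (D.hash₂.hash (ω.t₂ j) (restrict ω.x (S j) (P.len₂ n)))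

/-- Public transcript of the second phase; `none` if it does not take place or is aborted. -/
noncomputable def c₂ (ω : Outcome D) :
    Option ((Bool → Finset (Fin n)) × (Bool → D.hash₂.Seed) × (Bool → Bits (P.k₂ n))) :=
  ω.bob₁.bind fun s => (ω.bob₂ s.2).map fun S => (S, ω.t₂, ω.mask₂ S)

/-- Alice's final view `U`: strings, local randomness (the seeds), channel input, transcript. -/
noncomputable def viewA (ω : Outcome D) :=
  (ω.m₁, ω.m₂, ω.t₁, ω.t₂, ω.x, ω.c₁, ω.c₂)

/-- Bob-1's final view `V₁`: choice bit, local randomness, channel output, transcript. -/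
noncomputable def viewB₁ (ω : Outcome D) :=
  (ω.z₁, ω.rb₁, ω.y₁, ω.c₁, ω.c₂)

/-- Bob-2's final view `V₂`. -/
noncomputable def viewB₂ (ω : Outcome D) :=
  (ω.z₂, ω.rb₂, ω.y₂, ω.c₁, ω.c₂)

/-- Bob-1's estimate: he reads `x|_{S_{z₁}}` off his channel output and unmasks; `none` after an
abort. -/
noncomputable def est₁ (ω : Outcome D) : Option (Bits (P.k₁ n)) :=
  ω.c₁.map fun c => bxor (c.2.2.2 ω.z₁) (D.hash₁.hash (c.2.2.1 ω.z₁)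
    (restrict (fun l => (ω.y₁ l).getD false) (c.1 ω.z₁) (P.len₁ n)))

/-- Bob-2's estimate. -/
noncomputable def est₂ (ω : Outcome D) : Option (Bits (P.k₂ n)) :=
  ω.c₂.map fun c => bxor (c.2.2 ω.z₂) (D.hash₂.hash (c.2.1 ω.z₂)
    (restrict (fun l => (ω.y₂ l).getD false) (c.1 ω.z₂) (P.len₂ n)))

end Outcome

end BroadcastOT

/-! Correctness. Without an abort decoding is exact: the receiver knows the channel input on the set
labelled by his choice bit, so the mask cancels (`est₁_eq_of_bob₁`, `est₂_eq_of_bob₂`). Only aborts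
cause errors, and under the rate conditions an abort needs a binomial count to fall linearly below
its mean, which `prob_card_le_exp` makes exponentially rare.

Choice bits. Exchange erased and received positions on `S z ∪ S (!z)`. Both sets have the same size,
so the weight of the erasure pattern and every cardinality entering the abort tests and the sampling
probabilities stay the same, while the two labels change roles. The law of the announcement is
therefore independent of the choice bit (`prob_announce₁_bool_comm`, `prob_announce₂_bool_comm`),
and Alice and the other receiver see that bit only through the announcement.

Strings. One string, its hash seed and the channel input form a slot independent of all other
randomness; its label `j` may be computed from the randomness behind the index sets, so that `!z` is
allowed. Let the adversary have all the rest, the seed, the input outside a hidden set `U`, and the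
masked string. Leftover hashing (`mutualInfo_masked_le`, through the χ²-divergence) bounds the
information about the string by `2 ^ k / 2 ^ #U / Real.log 2`. The receivers' views are functions of
this leak, because the other masks use disjoint index sets and `U` is erased for the receivers
concerned (`agreeOff_of_slotLeak₁`, `agreeOff_of_slotLeak₂`).

For Bob-1's strings, `U` is the part of the index set erased for Bob-2. That set is drawn
independently of Bob-2's erasures, so `U` has more than `(p₂ - λ') ℓ₁ ≈ r₁ n` elements up to an
exponentially rare event, against `k₁ ≈ (r₁ - λ') n` bits. For Bob-2's strings, `U` is the whole
index set, of size `ℓ₂ ≈ r₂ n`. Both give `2 ^ (1 - λ' n)`. Joint statements follow from the chain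
rule `mutualInfo_pair_le`: conditioning on further strings is free, since the leak of one slot
contains the other strings in clear. -/

namespace BroadcastOT

/-! ### Information inequalities on finite probability spaces -/

section Information

variable {Ω Ω' : Type*} [Fintype Ω] [Fintype Ω'] {α β γ : Type*} {w : Ω → ℝ}

lemma prob_eq_sum (w : Ω → ℝ) (A : Ω → Prop) [DecidablePred A] :
    prob w A = ∑ ω, if A ω then w ω else 0 := by
  rw [prob]
  exact sum_congr rfl fun ω _ => by by_cases h : A ω <;> simp [h]

lemma prob_nonneg (hw : ∀ ω, 0 ≤ w ω) (A : Ω → Prop) : 0 ≤ prob w A := by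
  classical
  exact sum_nonneg fun ω _ => by split_ifs <;> simp [hw]

lemma prob_mono (hw : ∀ ω, 0 ≤ w ω) {A B : Ω → Prop} (h : ∀ ω, A ω → B ω) :
    prob w A ≤ prob w B := by
  refine sum_le_sum fun ω _ => ?_
  by_cases hA : A ω
  · simp [hA, h ω hA]
  · by_cases hB : B ω <;> simp [hA, hB, hw]

lemma prob_congr {A B : Ω → Prop} (h : ∀ ω, A ω ↔ B ω) : prob w A = prob w B := by
  congr 1; ext ω; exact h ω

lemma prob_pos (hw : ∀ ω, 0 ≤ w ω) {A : Ω → Prop} {ω : Ω} (hA : A ω) (h : 0 < w ω) :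
    0 < prob w A := by
  classical
  refine sum_pos' (fun ω _ => by split_ifs <;> simp [hw]) ⟨ω, mem_univ _, ?_⟩
  simpa [hA] using h

lemma prob_or_le (hw : ∀ ω, 0 ≤ w ω) (A B : Ω → Prop) :
    prob w (fun ω => A ω ∨ B ω) ≤ prob w A + prob w B := by
  rw [prob, prob, prob, ← sum_add_distrib]
  refine sum_le_sum fun ω _ => ?_
  by_cases hA : A ω <;> by_cases hB : B ω <;> simp [hA, hB, hw]

lemma prob_equiv (φ : Ω ≃ Ω') (w' : Ω' → ℝ) (hw' : ∀ ω, w' (φ ω) = w ω) (A : Ω → Prop) :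
    prob w A = prob w' (fun x => A (φ.symm x)) := by
  classical
  rw [prob, prob, ← φ.sum_comp]
  simp [hw']

lemma mutualInfo_equiv (φ : Ω ≃ Ω') (w' : Ω' → ℝ) (hw' : ∀ ω, w' (φ ω) = w ω)
    (X : Ω → α) (Y : Ω → β) :
    mutualInfo w X Y = mutualInfo w' (fun x => X (φ.symm x)) (fun x => Y (φ.symm x)) := by
  rw [mutualInfo, mutualInfo, ← φ.sum_comp]
  simp only [prob_equiv φ w' hw', hw', Equiv.symm_apply_apply]

lemma mutualInfo_eq_zero (X : Ω → α) (Y : Ω → β)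
    (h : ∀ x y, prob w (fun ω => X ω = x ∧ Y ω = y) =
      prob w (fun ω => X ω = x) * prob w (fun ω => Y ω = y)) :
    mutualInfo w X Y = 0 := by
  refine sum_eq_zero fun ω _ => ?_
  rw [h]
  by_cases h0 : prob w (fun ω' => X ω' = X ω) * prob w (fun ω' => Y ω' = Y ω) = 0
  -- Here the ratio is a division by zero, hence 0, and `Real.logb 2 0 = 0`.
  · simp [h0]
  · simp [div_self h0]

/-- The weights of the fibres of a random variable, summed against a function of it. -/
lemma sum_mul_div_prob_le [DecidableEq α] (X : Ω → α) (q : α → ℝ)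
    (hq : ∀ x, 0 ≤ q x) :
    ∑ ω, w ω * (q (X ω) / prob w (fun ω' => X ω' = X ω)) ≤ ∑ x ∈ univ.image X, q x := by
  classical
  rw [← sum_fiberwise_of_maps_to (g := X) (t := univ.image X) (by simp)]
  refine sum_le_sum fun x _ => ?_
  have h1 : ∑ ω with X ω = x, w ω * (q (X ω) / prob w (fun ω' => X ω' = X ω)) =
      prob w (fun ω' => X ω' = x) * (q x / prob w (fun ω' => X ω' = x)) := by
    have h2 : ∑ ω with X ω = x, w ω = prob w (fun ω' => X ω' = x) := by
      rw [prob_eq_sum, sum_filter]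
    trans (∑ ω with X ω = x, w ω) * (q x / prob w (fun ω' => X ω' = x))
    · rw [sum_mul]
      refine sum_congr rfl fun ω hω => ?_
      rw [(mem_filter.1 hω).2]
    · rw [h2]
  rw [h1]
  by_cases h0 : prob w (fun ω' => X ω' = x) = 0
  · simp [h0, hq]
  · rw [mul_div_cancel₀ _ h0]

/-- Gibbs' inequality, from `log t ≥ 1 - 1/t` applied termwise. The comparison weights `q` only need
total mass at most 1 on the range of `X`. -/
lemma sum_logb_div_nonneg (hw : ∀ ω, 0 ≤ w ω) (h1 : ∑ ω, w ω = 1) [DecidableEq α] (X : Ω → α)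
    (q : α → ℝ) (hq : ∀ x, 0 ≤ q x) (hq0 : ∀ ω, 0 < w ω → 0 < q (X ω))
    (hq1 : ∑ x ∈ univ.image X, q x ≤ 1) :
    0 ≤ ∑ ω, w ω * Real.logb 2 (prob w (fun ω' => X ω' = X ω) / q (X ω)) := by
  have h2 := (sum_mul_div_prob_le (w := w) X q hq).trans hq1
  have hlog : 0 < Real.log 2 := Real.log_pos one_lt_two
  have h3 : ∀ ω, w ω * (1 - q (X ω) / prob w (fun ω' => X ω' = X ω)) / Real.log 2 ≤
      w ω * Real.logb 2 (prob w (fun ω' => X ω' = X ω) / q (X ω)) := by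
    intro ω
    rcases (hw ω).eq_or_lt with h | h
    · simp [← h]
    · rw [mul_div_assoc]
      refine mul_le_mul_of_nonneg_left ?_ h.le
      rw [Real.logb]
      refine div_le_div_of_nonneg_right ?_ hlog.le
      have hp := prob_pos hw (A := fun ω' => X ω' = X ω) rfl h
      have := Real.one_sub_inv_le_log_of_pos (div_pos hp (hq0 ω h))
      rwa [inv_div] at this
  refine le_trans ?_ (sum_le_sum fun ω _ => h3 ω)
  rw [← sum_div]
  refine div_nonneg ?_ hlog.le
  simp only [mul_sub, mul_one, sum_sub_distrib, h1]
  linarith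

lemma sum_image_prob_and [DecidableEq α] (X : Ω → α) (A : Ω → Prop) :
    ∑ x ∈ univ.image X, prob w (fun ω => X ω = x ∧ A ω) = prob w A := by
  classical
  simp only [prob_eq_sum]
  rw [sum_comm]
  refine sum_congr rfl fun ω _ => ?_
  simp only [ite_and]
  rw [sum_ite_eq, if_pos (by simp)]

lemma sum_image_prob [DecidableEq α] (h1 : ∑ ω, w ω = 1) (X : Ω → α) :
    ∑ x ∈ univ.image X, prob w (fun ω => X ω = x) = 1 := by
  have h := sum_image_prob_and (w := w) X fun _ => True
  have h2 : prob w (fun _ => True) = 1 := by simp [prob, h1]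
  simpa only [and_true, h2] using h

/-- Data processing: a random variable `Z` determined by `Y` carries no more information. -/
lemma mutualInfo_le_of_determined (hw : ∀ ω, 0 ≤ w ω) (h1 : ∑ ω, w ω = 1)
    (X : Ω → α) (Y : Ω → β) (Z : Ω → γ) (h : ∀ ω ω', Y ω = Y ω' → Z ω = Z ω') :
    mutualInfo w X Z ≤ mutualInfo w X Y := by
  classical
  have hne : Nonempty Ω := by
    by_contra hne
    rw [not_nonempty_iff] at hne
    simp at h1
  obtain ⟨ω₀⟩ := hne
  have : Nonempty γ := ⟨Z ω₀⟩
  obtain ⟨f, rfl⟩ := (Function.factorsThrough_iff Z).1 (fun ω ω' => h ω ω')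
  -- `q` is the law that makes `X` and `Y` conditionally independent given `f Y`. The divergence of
  -- the true law from `q` is exactly the difference of the two mutual informations.
  set q : α × β → ℝ := fun v => prob w (fun ω => Y ω = v.2) *
    (prob w (fun ω => X ω = v.1 ∧ f (Y ω) = f v.2) / prob w (fun ω => f (Y ω) = f v.2)) with hq
  have hq0 : ∀ v, 0 ≤ q v := fun v => mul_nonneg (prob_nonneg hw _)
    (div_nonneg (prob_nonneg hw _) (prob_nonneg hw _))
  have hsum : ∑ v ∈ univ.image (fun ω => (X ω, Y ω)), q v ≤ 1 := by
    calc ∑ v ∈ univ.image (fun ω => (X ω, Y ω)), q v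
        ≤ ∑ v ∈ univ.image X ×ˢ univ.image Y, q v := by
          refine sum_le_sum_of_subset_of_nonneg ?_ fun v _ _ => hq0 v
          intro v hv
          obtain ⟨ω, -, rfl⟩ := mem_image.1 hv
          simp
      _ = ∑ y ∈ univ.image Y, ∑ x ∈ univ.image X, q (x, y) := by
          rw [sum_product, sum_comm]
      _ ≤ ∑ y ∈ univ.image Y, prob w (fun ω => Y ω = y) := by
          refine sum_le_sum fun y _ => ?_
          simp only [hq]
          rw [← mul_sum, ← sum_div, sum_image_prob_and]
          -- Only an inequality, since the quotient is 0 rather than 1 when the denominator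
          -- vanishes.
          exact mul_le_of_le_one_right (prob_nonneg hw _) (div_self_le_one _)
      _ = 1 := sum_image_prob h1 Y
  have key := sum_logb_div_nonneg hw h1 (fun ω => (X ω, Y ω)) q hq0 (fun ω h => ?_) hsum
  · rw [← sub_nonneg, mutualInfo, mutualInfo, ← sum_sub_distrib]
    refine key.trans_eq (sum_congr rfl fun ω _ => ?_)
    rcases (hw ω).eq_or_lt with h | h
    · simp [← h]
    · rw [← mul_sub]
      congr 1
      have a1 := prob_pos hw (A := fun ω' => X ω' = X ω ∧ Y ω' = Y ω) ⟨rfl, rfl⟩ h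
      have a2 := prob_pos hw (A := fun ω' => X ω' = X ω) rfl h
      have a3 := prob_pos hw (A := fun ω' => Y ω' = Y ω) rfl h
      have a4 := prob_pos hw (A := fun ω' => X ω' = X ω ∧ f (Y ω') = f (Y ω)) ⟨rfl, rfl⟩ h
      have a5 := prob_pos hw (A := fun ω' => f (Y ω') = f (Y ω)) rfl h
      simp only [Function.comp_apply]
      rw [← Real.logb_div (by positivity) (by positivity)]
      congr 1
      simp only [hq, Prod.mk.injEq]
      field_simp
  · have a3 := prob_pos hw (A := fun ω' => Y ω' = Y ω) rfl h
    have a4 := prob_pos hw (A := fun ω' => X ω' = X ω ∧ f (Y ω') = f (Y ω)) ⟨rfl, rfl⟩ h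
    have a5 := prob_pos hw (A := fun ω' => f (Y ω') = f (Y ω)) rfl h
    simp only [hq]
    positivity

/-- Data processing down to a constant, which carries no information. -/
lemma mutualInfo_nonneg (hw : ∀ ω, 0 ≤ w ω) (h1 : ∑ ω, w ω = 1) (X : Ω → α) (Y : Ω → β) :
    0 ≤ mutualInfo w X Y := by
  refine le_trans (le_of_eq ?_)
    (mutualInfo_le_of_determined hw h1 X Y (fun _ => ()) fun _ _ _ => rfl)
  refine (mutualInfo_eq_zero _ _ fun x y => ?_).symm
  have : prob w (fun _ : Ω => () = y) = 1 := by simp [prob, h1]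
  rw [this, mul_one]
  exact prob_congr fun ω => by simp

/-- Subadditive form of the chain rule. -/
lemma mutualInfo_pair_le (hw : ∀ ω, 0 ≤ w ω) (h1 : ∑ ω, w ω = 1)
    (X₁ : Ω → α) (X₂ : Ω → β) (Y : Ω → γ) :
    mutualInfo w (fun ω => (X₁ ω, X₂ ω)) Y ≤
      mutualInfo w X₁ Y + mutualInfo w X₂ (fun ω => (X₁ ω, Y ω)) := by
  -- The two expansions of the chain rule agree exactly; the inequality comes from dropping
  -- `I(X₂;X₁) ≥ 0`.
  have h : mutualInfo w (fun ω => (X₁ ω, X₂ ω)) Y + mutualInfo w X₂ X₁ =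
      mutualInfo w X₁ Y + mutualInfo w X₂ (fun ω => (X₁ ω, Y ω)) := by
    simp only [mutualInfo]
    rw [← sum_add_distrib, ← sum_add_distrib]
    refine sum_congr rfl fun ω _ => ?_
    rcases (hw ω).eq_or_lt with h | h
    · simp [← h]
    · rw [← mul_add, ← mul_add]
      congr 1
      have e1 : prob w (fun ω' => X₂ ω' = X₂ ω ∧ (X₁ ω', Y ω') = (X₁ ω, Y ω)) =
          prob w (fun ω' => (X₁ ω', X₂ ω') = (X₁ ω, X₂ ω) ∧ Y ω' = Y ω) :=
        prob_congr fun ω' => by simp only [Prod.mk.injEq]; tauto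
      have e2 : prob w (fun ω' => (X₁ ω', X₂ ω') = (X₁ ω, X₂ ω)) =
          prob w (fun ω' => X₂ ω' = X₂ ω ∧ X₁ ω' = X₁ ω) :=
        prob_congr fun ω' => by simp only [Prod.mk.injEq]; tauto
      have e3 : prob w (fun ω' => (X₁ ω', Y ω') = (X₁ ω, Y ω)) =
          prob w (fun ω' => X₁ ω' = X₁ ω ∧ Y ω' = Y ω) :=
        prob_congr fun ω' => by simp only [Prod.mk.injEq]
      rw [e1, e2, e3]
      have a1 := prob_pos hw (A := fun ω' => (X₁ ω', X₂ ω') = (X₁ ω, X₂ ω) ∧ Y ω' = Y ω)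
        ⟨rfl, rfl⟩ h
      have a2 := prob_pos hw (A := fun ω' => X₂ ω' = X₂ ω ∧ X₁ ω' = X₁ ω) ⟨rfl, rfl⟩ h
      have a3 := prob_pos hw (A := fun ω' => X₁ ω' = X₁ ω ∧ Y ω' = Y ω) ⟨rfl, rfl⟩ h
      have a4 := prob_pos hw (A := fun ω' => X₁ ω' = X₁ ω) rfl h
      have a5 := prob_pos hw (A := fun ω' => X₂ ω' = X₂ ω) rfl h
      have a6 := prob_pos hw (A := fun ω' => Y ω' = Y ω) rfl h
      rw [← Real.logb_mul (by positivity) (by positivity),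
        ← Real.logb_mul (by positivity) (by positivity)]
      congr 1
      field_simp
  linarith [mutualInfo_nonneg hw h1 X₂ X₁]

/-- The bound holds pointwise: `P(x,y) ≤ P(y)`, so the logarithm is at most that of `1 / P(x) = 2 ^
k`. -/
lemma mutualInfo_le_of_uniform (hw : ∀ ω, 0 ≤ w ω) (h1 : ∑ ω, w ω = 1) (X : Ω → α) (Y : Ω → β)
    (k : ℕ) (hX : ∀ x, prob w (fun ω => X ω = x) = (2 : ℝ)⁻¹ ^ k) : mutualInfo w X Y ≤ k := by
  rw [← mul_one (k : ℝ), ← h1, mul_sum, mutualInfo]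
  refine sum_le_sum fun ω _ => ?_
  rcases (hw ω).eq_or_lt with h | h
  · simp [← h]
  · rw [mul_comm (k : ℝ)]
    refine mul_le_mul_of_nonneg_left ?_ h.le
    have a1 := prob_pos hw (A := fun ω' => X ω' = X ω ∧ Y ω' = Y ω) ⟨rfl, rfl⟩ h
    have a2 := prob_pos hw (A := fun ω' => Y ω' = Y ω) rfl h
    have a3 : prob w (fun ω' => X ω' = X ω ∧ Y ω' = Y ω) ≤ prob w (fun ω' => Y ω' = Y ω) :=
      prob_mono hw fun ω' h => h.2
    rw [hX, Real.logb_le_iff_le_rpow one_lt_two (by positivity), div_le_iff₀ (by positivity),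
      Real.rpow_natCast, inv_pow, mul_inv_cancel_left₀ (by positivity)]
    exact a3

/-- Mutual information is bounded by the `χ²`-divergence. -/
lemma mutualInfo_le_chi_sq (hw : ∀ ω, 0 ≤ w ω) (h1 : ∑ ω, w ω = 1) (X : Ω → α) (Y : Ω → β) :
    mutualInfo w X Y ≤ (∑ ω, w ω * (prob w (fun ω' => X ω' = X ω ∧ Y ω' = Y ω) /
      (prob w (fun ω' => X ω' = X ω) * prob w (fun ω' => Y ω' = Y ω))) - 1) / Real.log 2 := by
  have hlog : 0 < Real.log 2 := Real.log_pos one_lt_two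
  rw [← h1, ← sum_sub_distrib, sum_div, mutualInfo]
  refine sum_le_sum fun ω _ => ?_
  rcases (hw ω).eq_or_lt with h | h
  · simp [← h]
  · have a1 := prob_pos hw (A := fun ω' => X ω' = X ω ∧ Y ω' = Y ω) ⟨rfl, rfl⟩ h
    have a2 := prob_pos hw (A := fun ω' => X ω' = X ω) rfl h
    have a3 := prob_pos hw (A := fun ω' => Y ω' = Y ω) rfl h
    rw [Real.logb, ← mul_sub_one, mul_div_assoc]
    refine mul_le_mul_of_nonneg_left (div_le_div_of_nonneg_right ?_ hlog.le) h.le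
    exact Real.log_le_sub_one_of_pos (by positivity)

lemma prob_prod {A B : Type*} [Fintype A] [Fintype B] (wA : A → ℝ) (wB : B → ℝ)
    (E : A × B → Prop) :
    prob (fun v : A × B => wA v.1 * wB v.2) E = ∑ a, wA a * prob wB (fun b => E (a, b)) := by
  classical
  simp only [prob, Fintype.sum_prod_type, mul_sum, mul_ite, mul_zero]

/-- Side information independent of `X` can be conditioned on. -/
lemma mutualInfo_prod {A B : Type*} [Fintype A] [Fintype B] {wA : A → ℝ} {wB : B → ℝ}
    (hA : ∑ a, wA a = 1) (X : B → α) (Y : A → B → β) :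
    mutualInfo (fun v : A × B => wA v.1 * wB v.2) (fun v => X v.2) (fun v => (v.1, Y v.1 v.2)) =
      ∑ a, wA a * mutualInfo wB X (Y a) := by
  classical
  have e1 : ∀ x, prob (fun v : A × B => wA v.1 * wB v.2) (fun v => X v.2 = x) =
      prob wB (fun b => X b = x) := by
    intro x
    rw [prob_prod]
    simp [← sum_mul, hA]
  have e2 : ∀ a y, prob (fun v : A × B => wA v.1 * wB v.2) (fun v => (v.1, Y v.1 v.2) = (a, y)) =
      wA a * prob wB (fun b => Y a b = y) := by
    intro a y
    rw [prob_prod, sum_eq_single a]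
    · simp
    · intro a' _ h
      simp [h, prob]
    · simp
  have e3 : ∀ x a y, prob (fun v : A × B => wA v.1 * wB v.2)
      (fun v => X v.2 = x ∧ (v.1, Y v.1 v.2) = (a, y)) =
      wA a * prob wB (fun b => X b = x ∧ Y a b = y) := by
    intro x a y
    rw [prob_prod, sum_eq_single a]
    · simp
    · intro a' _ h
      simp [h, prob]
    · simp
  simp only [mutualInfo, e1, e2, e3, Fintype.sum_prod_type, mul_sum]
  refine sum_congr rfl fun a _ => sum_congr rfl fun b _ => ?_
  -- The factor `wA a` cancels in the ratio; where it is zero the whole term vanishes.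
  by_cases h : wA a = 0
  · simp [h]
  · rw [mul_left_comm (prob wB fun b' => X b' = X b), mul_div_mul_left _ _ h, mul_assoc]

/-- A uniform bit `Z` such that `Y` has the same weights on `Z = true` and on `Z = false` is
independent of `Y`. -/
lemma mutualInfo_bit_eq_zero (h1 : ∑ ω, w ω = 1) (Z : Ω → Bool) (Y : Ω → β)
    (h : ∀ y, prob w (fun ω => Z ω = true ∧ Y ω = y) = prob w (fun ω => Z ω = false ∧ Y ω = y))
    (hZ : prob w (fun ω => Z ω = true) = prob w (fun ω => Z ω = false)) :
    mutualInfo w Z Y = 0 := by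
  have split : ∀ A : Ω → Prop, prob w A =
      prob w (fun ω => Z ω = true ∧ A ω) + prob w (fun ω => Z ω = false ∧ A ω) := by
    intro A
    simp only [prob]
    rw [← sum_add_distrib]
    refine sum_congr rfl fun ω _ => ?_
    by_cases hA : A ω <;> by_cases hz : Z ω = true <;> simp [hA, hz]
  have ht := split fun _ => True
  simp only [and_true] at ht
  have ht' : prob w (fun _ => True) = 1 := by simp [prob, h1]
  refine mutualInfo_eq_zero _ _ fun z y => ?_
  have hy := split fun ω => Y ω = y
  have := h y
  cases z
  · rw [show prob w (fun ω => Z ω = false) = 1 / 2 by linarith]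
    linarith
  · rw [show prob w (fun ω => Z ω = true) = 1 / 2 by linarith]
    linarith

end Information

/-! ### Chernoff bound for Bernoulli counts -/

section Tail

variable {n : ℕ}

lemma bern_nonneg {p : ℝ} (h0 : 0 ≤ p) (h1 : p ≤ 1) (b : Bool) : 0 ≤ bern p b := by
  cases b <;> simp [bern, h0, h1]

lemma bern_le_one {p : ℝ} (h0 : 0 ≤ p) (h1 : p ≤ 1) (b : Bool) : bern p b ≤ 1 := by
  cases b <;> simp [bern, h0, h1]

lemma sum_prod_apply (g : Fin n → Bool → ℝ) :
    ∑ e : Fin n → Bool, ∏ l, g l (e l) = ∏ l, (g l true + g l false) := by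
  have := Finset.prod_univ_sum (fun _ : Fin n => (univ : Finset Bool)) g
  rw [Fintype.piFinset_univ] at this
  rw [← this]
  simp

/-- The law of i.i.d. Bernoulli(`p`) bits. -/
noncomputable def bernWeight (p : ℝ) (e : Fin n → Bool) : ℝ := ∏ l, bern p (e l)

lemma sum_bernWeight (p : ℝ) : ∑ e : Fin n → Bool, bernWeight p e = 1 := by
  simp only [bernWeight]
  rw [sum_prod_apply fun _ b => bern p b]
  simp [bern]

/-- Combines `1 + t + t²/2 ≤ exp t` with `(1 - t + t²/2)(1 + t + t²/2) = 1 + t⁴/4 ≥ 1`. -/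
lemma exp_neg_le_quadratic {t : ℝ} (ht : 0 ≤ t) : Real.exp (-t) ≤ 1 - t + t ^ 2 / 2 := by
  rw [Real.exp_neg, inv_le_comm₀ (Real.exp_pos t) (by nlinarith [sq_nonneg (t - 1)])]
  refine le_trans ?_ (Real.quadratic_le_exp_of_nonneg ht)
  rw [inv_le_iff_one_le_mul₀ (by nlinarith [sq_nonneg (t - 1)])]
  nlinarith [sq_nonneg (t ^ 2)]

/-- Chernoff bound for the lower tail of the number of positions of `R` with value `v`. -/
lemma prob_card_le_exp {p : ℝ} (h0 : 0 ≤ p) (h1 : p ≤ 1) (R : Finset (Fin n)) (v : Bool) {δ : ℝ}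
    (hδ : 0 ≤ δ) :
    prob (bernWeight p)
      (fun e : Fin n → Bool => (#{l ∈ R | e l = v} : ℝ) ≤ (bern p v - δ) * #R) ≤
      Real.exp (-(δ ^ 2 / 2 * #R)) := by
  classical
  set q := bern p v with hq
  have hq0 : 0 ≤ q := bern_nonneg h0 h1 v
  have hq1 : q ≤ 1 := bern_le_one h0 h1 v
  -- The moment generating function of the count, with the deviation `δ` itself as exponential
  -- parameter.
  have hsum : ∑ e : Fin n → Bool, bernWeight p e * Real.exp (-δ * #{l ∈ R | e l = v}) =
      (q * Real.exp (-δ) + (1 - q)) ^ #R := by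
    have e1 : ∀ e : Fin n → Bool, bernWeight p e * Real.exp (-δ * #{l ∈ R | e l = v}) =
        ∏ l, bern p (e l) * if l ∈ R ∧ e l = v then Real.exp (-δ) else 1 := by
      intro e
      rw [bernWeight, prod_mul_distrib, mul_comm (-δ), Real.exp_nat_mul, prod_ite, prod_const_one, mul_one,
        prod_const]
      congr 3
      ext l
      simp
    simp only [e1]
    rw [sum_prod_apply fun l b => bern p b * if l ∈ R ∧ b = v then Real.exp (-δ) else 1,
      ← prod_const, ← prod_subset (subset_univ R)]
    · refine prod_congr rfl fun l hl => ?_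
      cases v <;> simp [hl, hq, bern]
      ring
    · intro l _ hl
      simp [hl, bern]
  have hbase : q * Real.exp (-δ) + (1 - q) ≤ Real.exp (-q * (δ - δ ^ 2 / 2)) := by
    have := Real.add_one_le_exp (-q * (δ - δ ^ 2 / 2))
    have := mul_le_mul_of_nonneg_left (exp_neg_le_quadratic hδ) hq0
    nlinarith
  have hbase0 : 0 ≤ q * Real.exp (-δ) + (1 - q) := by
    have := mul_nonneg hq0 (Real.exp_pos (-δ)).le
    linarith
  calc prob (bernWeight p)
          (fun e : Fin n → Bool => (#{l ∈ R | e l = v} : ℝ) ≤ (q - δ) * #R)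
    _ ≤ ∑ e : Fin n → Bool, Real.exp (δ * ((q - δ) * #R)) *
          (bernWeight p e * Real.exp (-δ * #{l ∈ R | e l = v})) := by
        rw [prob_eq_sum]
        refine sum_le_sum fun e _ => ?_
        have hpos : 0 ≤ bernWeight p e := prod_nonneg fun l _ => bern_nonneg h0 h1 _
        split_ifs with h
        · rw [mul_left_comm, ← Real.exp_add]
          refine le_mul_of_one_le_right hpos (Real.one_le_exp ?_)
          nlinarith
        · positivity
    _ = Real.exp (δ * ((q - δ) * #R)) * (q * Real.exp (-δ) + (1 - q)) ^ #R := by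
        rw [← mul_sum, hsum]
    _ ≤ Real.exp (δ * ((q - δ) * #R)) * Real.exp (-q * (δ - δ ^ 2 / 2)) ^ #R := by gcongr
    _ = Real.exp (δ * ((q - δ) * #R) + #R * (-q * (δ - δ ^ 2 / 2))) := by
        rw [← Real.exp_nat_mul, ← Real.exp_add]
    _ ≤ Real.exp (-(δ ^ 2 / 2 * #R)) := by
        refine Real.exp_le_exp.2 ?_
        -- Per position the exponent is `δ(q - δ) - q(δ - δ²/2) = -δ²/2 - (1 - q)δ²/2`.
        have : 0 ≤ (1 - q) * (δ ^ 2 * #R) := mul_nonneg (by linarith) (by positivity)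
        nlinarith

end Tail

/-! ### Leftover hashing -/

section Hashing

variable {n k : ℕ}

/-- The string `x` with the positions in `U` blanked out. -/
def hideOn (U : Finset (Fin n)) (x : Fin n → Bool) : Fin n → Bool :=
  fun l => if l ∈ U then false else x l

lemma hideOn_eq_iff {U : Finset (Fin n)} {x x' : Fin n → Bool} :
    hideOn U x = hideOn U x' ↔ ∀ l ∉ U, x l = x' l := by
  rw [funext_iff]
  refine forall_congr' fun l => ?_
  by_cases h : l ∈ U <;> simp [hideOn, h]

lemma card_hideOn_eq (U : Finset (Fin n)) (x : Fin n → Bool) :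
    #{x' | hideOn U x' = hideOn U x} = 2 ^ #U := by
  have : ({x' | hideOn U x' = hideOn U x} : Finset (Fin n → Bool)) =
      Fintype.piFinset fun l => if l ∈ U then univ else {x l} := by
    ext x'
    simp only [mem_filter, mem_univ, true_and, hideOn_eq_iff, Fintype.mem_piFinset]
    refine forall_congr' fun l => ?_
    by_cases h : l ∈ U <;> simp [h]
  rw [this, Fintype.card_piFinset, ← prod_subset (subset_univ U)]
  · rw [prod_congr rfl (g := fun _ => 2), prod_const]
    intro l hl
    simp [hl]
  · intro l _ hl
    simp [hl]

lemma bxor_left_inj {a b c : Bits k} : bxor a b = bxor a c ↔ b = c := by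
  refine ⟨fun h => ?_, fun h => h ▸ rfl⟩
  funext i
  simpa [bxor] using congrFun h i

lemma bxor_bxor_right (a b : Bits k) : bxor (bxor a b) b = a := by
  funext i
  simp [bxor]

lemma bxor_eq_iff {a b c : Bits k} : bxor a b = c ↔ a = bxor c b := by
  constructor
  · rintro rfl
    rw [bxor_bxor_right]
  · rintro rfl
    rw [bxor_bxor_right]

lemma prob_const {Ω : Type*} [Fintype Ω] (c : ℝ) (A : Ω → Prop) [DecidablePred A] :
    prob (fun _ => c) A = c * #{ω | A ω} := by
  rw [prob_eq_sum, ← sum_filter, sum_const, nsmul_eq_mul, mul_comm]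

/-- Two-universality speaks of distinct hash inputs. This makes distinct channel inputs that agree
off `U` give distinct restrictions to `S ⊇ U`. -/
lemma restrict_injOn {ℓ : ℕ} {U S : Finset (Fin n)} (hUS : U ⊆ S) (hS : #S = ℓ)
    {x x' : Fin n → Bool} (h : hideOn U x = hideOn U x')
    (hr : restrict x S ℓ = restrict x' S ℓ) : x = x' := by
  funext l
  by_cases hl : l ∈ U
  · have : l ∈ Set.range (S.orderEmbOfFin hS) := by
      rw [range_orderEmbOfFin]
      exact hUS hl
    obtain ⟨j, rfl⟩ := this
    simpa [restrict, hS] using congrFun hr j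
  · exact hideOn_eq_iff.1 h l hl

/-- The weights of a uniform string, seed and channel input. -/
noncomputable def slotWeight {T : Type*} [Fintype T] (v : Bits k × T × (Fin n → Bool)) : ℝ :=
  unif v.1 * (unif v.2.1 * unif v.2.2)

lemma sum_unif {α : Type*} [Fintype α] [Nonempty α] : ∑ a : α, unif a = 1 := by
  simp [unif]

lemma unif_nonneg {α : Type*} [Fintype α] (a : α) : 0 ≤ unif a := by
  simp [unif]

lemma slotWeight_nonneg {T : Type*} [Fintype T] (v : Bits k × T × (Fin n → Bool)) : 0 ≤ slotWeight v :=
  mul_nonneg (unif_nonneg _) (mul_nonneg (unif_nonneg _) (unif_nonneg _))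

variable {T : Type*} [Fintype T] [Nonempty T]

lemma sum_slotWeight : ∑ v : Bits k × T × (Fin n → Bool), slotWeight v = 1 := by
  simp only [slotWeight, Fintype.sum_prod_type, ← mul_sum, sum_unif, mul_one]

lemma prob_slotWeight_fst (m : Bits k) :
    prob (slotWeight : Bits k × T × (Fin n → Bool) → ℝ) (fun v => v.1 = m) = (2 : ℝ)⁻¹ ^ k := by
  classical
  rw [prob_eq_sum]
  simp only [slotWeight, Fintype.sum_prod_type]
  rw [sum_eq_single m]
  · simp only [if_true, ← mul_sum, sum_unif, mul_one]
    simp [unif]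
  · intro m' _ h
    simp [h]
  · simp

/-- Leftover hashing: a uniform string masked by a hash value of an input of which the positions
in `U` are unknown. -/
lemma mutualInfo_masked_le (U : Finset (Fin n)) (g : T → (Fin n → Bool) → Bits k)
    (hg : ∀ x x', x ≠ x' → hideOn U x = hideOn U x' →
      (Nat.card {t : T // g t x = g t x'} : ℝ) / Fintype.card T ≤ (2 : ℝ)⁻¹ ^ k) :
    mutualInfo (slotWeight : Bits k × T × (Fin n → Bool) → ℝ) (fun v => v.1)
      (fun v => (v.2.1, hideOn U v.2.2, some (bxor v.1 (g v.2.1 v.2.2)))) ≤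
      2 ^ k / 2 ^ #U / Real.log 2 := by
  classical
  have hlog : 0 < Real.log 2 := Real.log_pos one_lt_two
  refine (mutualInfo_le_chi_sq slotWeight_nonneg sum_slotWeight _ _).trans
    (div_le_div_of_nonneg_right ?_ hlog.le)
  -- All slot outcomes have this same weight, so probabilities become counts.
  set c : ℝ := 1 / Fintype.card (Bits k) *
    (1 / Fintype.card T * (1 / Fintype.card (Fin n → Bool))) with hc
  have hcT : (0 : ℝ) < Fintype.card T := by exact_mod_cast Fintype.card_pos
  have hc0 : 0 < c := by
    simp only [hc, Fintype.card_fun, Fintype.card_bool, Fintype.card_fin]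
    positivity
  have hw : (slotWeight : Bits k × T × (Fin n → Bool) → ℝ) = fun _ => c := rfl
  -- The inputs that remain possible once the string is known along with the view: the masked value
  -- then fixes the hash value.
  set N : T → (Fin n → Bool) → ℕ :=
    fun t x => #{x' | hideOn U x' = hideOn U x ∧ g t x' = g t x} with hN
  -- Each input agreeing off `U` is compatible with the view through exactly one string, so there
  -- are `2 ^ #U` compatible outcomes.
  have eY : ∀ v : Bits k × T × (Fin n → Bool), prob slotWeight
      (fun v' : Bits k × T × (Fin n → Bool) =>
        (v'.2.1, hideOn U v'.2.2, some (bxor v'.1 (g v'.2.1 v'.2.2))) =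
          (v.2.1, hideOn U v.2.2, some (bxor v.1 (g v.2.1 v.2.2)))) = c * 2 ^ #U := by
    rintro ⟨m, t, x⟩
    rw [hw, prob_const]
    have : ({v' | (v'.2.1, hideOn U v'.2.2, some (bxor v'.1 (g v'.2.1 v'.2.2))) =
          (t, hideOn U x, some (bxor m (g t x)))} : Finset (Bits k × T × (Fin n → Bool))) =
        image (fun x' => (bxor (bxor m (g t x)) (g t x'), t, x'))
          {x' | hideOn U x' = hideOn U x} := by
      ext ⟨m', t', x'⟩
      simp only [mem_filter, mem_univ, true_and, Prod.mk.injEq, Option.some.injEq, mem_image]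
      constructor
      · rintro ⟨rfl, h, h'⟩
        exact ⟨x', h, (bxor_eq_iff.1 h').symm, rfl, rfl⟩
      · rintro ⟨x'', h, h', rfl, rfl⟩
        exact ⟨rfl, h, bxor_eq_iff.2 h'.symm⟩
    simp only [this]
    rw [card_image_of_injective _ fun x x' h => (Prod.mk.inj (Prod.mk.inj h).2).2,
      card_hideOn_eq]
    simp
  have eXY : ∀ v : Bits k × T × (Fin n → Bool), prob slotWeight
      (fun v' : Bits k × T × (Fin n → Bool) => v'.1 = v.1 ∧
        (v'.2.1, hideOn U v'.2.2, some (bxor v'.1 (g v'.2.1 v'.2.2))) =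
          (v.2.1, hideOn U v.2.2, some (bxor v.1 (g v.2.1 v.2.2)))) = c * N v.2.1 v.2.2 := by
    rintro ⟨m, t, x⟩
    rw [hw, prob_const]
    have : ({v' | v'.1 = m ∧ (v'.2.1, hideOn U v'.2.2, some (bxor v'.1 (g v'.2.1 v'.2.2))) =
          (t, hideOn U x, some (bxor m (g t x)))} : Finset (Bits k × T × (Fin n → Bool))) =
        image (fun x' => (m, t, x')) {x' | hideOn U x' = hideOn U x ∧ g t x' = g t x} := by
      ext ⟨m', t', x'⟩
      simp only [mem_filter, mem_univ, true_and, Prod.mk.injEq, Option.some.injEq, mem_image]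
      constructor
      · rintro ⟨rfl, rfl, h, h'⟩
        exact ⟨x', ⟨h, bxor_left_inj.1 h'⟩, rfl, rfl, rfl⟩
      · rintro ⟨x'', ⟨h, h'⟩, rfl, rfl, rfl⟩
        exact ⟨rfl, rfl, h, by rw [h']⟩
    simp only [this]
    rw [card_image_of_injective _ fun x x' h => (Prod.mk.inj (Prod.mk.inj h).2).2]
  -- The input `x` collides with itself for every seed, giving the 1; each of the fewer than `2 ^
  -- #U` others collides for a fraction at most `2⁻ᵏ` of the seeds.
  have hNsum : ∀ x, ∑ t, (N t x : ℝ) ≤ Fintype.card T * (1 + 2 ^ #U * (2 : ℝ)⁻¹ ^ k) := by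
    intro x
    have e1 : ∑ t, (N t x : ℝ) =
        ∑ x' with hideOn U x' = hideOn U x, (#{t | g t x' = g t x} : ℝ) := by
      simp only [hN, card_filter, ite_and, Nat.cast_sum, sum_filter]
      rw [sum_comm]
      refine sum_congr rfl fun x' _ => ?_
      split_ifs <;> simp
    have e2 : ∀ x' ∈ ({x' | hideOn U x' = hideOn U x} : Finset (Fin n → Bool)).erase x,
        (#{t | g t x' = g t x} : ℝ) ≤ Fintype.card T * (2 : ℝ)⁻¹ ^ k := by
      intro x' hx'
      rw [mem_erase, mem_filter] at hx'
      have := hg x' x hx'.1 hx'.2.2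
      rwa [div_le_iff₀ hcT, mul_comm, Nat.card_eq_fintype_card, Fintype.card_subtype] at this
    rw [e1, ← add_sum_erase _ _ (show x ∈ _ from by simp)]
    have e3 := sum_le_card_nsmul _ _ _ e2
    have e4 : #(({x' | hideOn U x' = hideOn U x} : Finset (Fin n → Bool)).erase x) ≤ 2 ^ #U :=
      (card_erase_le).trans (card_hideOn_eq U x).le
    have e5 : ((#(({x' | hideOn U x' = hideOn U x} : Finset (Fin n → Bool)).erase x) : ℕ) : ℝ) ≤
        2 ^ #U := by exact_mod_cast e4
    rw [nsmul_eq_mul] at e3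
    have e6 := e3.trans (mul_le_mul_of_nonneg_right e5 (by positivity))
    simp only [filter_true, card_univ]
    nlinarith
  simp only [eXY, eY, prob_slotWeight_fst]
  simp only [hw]
  have e7 : ∀ v : Bits k × T × (Fin n → Bool),
      c * (c * (N v.2.1 v.2.2 : ℝ) / ((2 : ℝ)⁻¹ ^ k * (c * 2 ^ #U))) =
      c * 2 ^ k / 2 ^ #U * N v.2.1 v.2.2 := by
    intro v
    rw [inv_pow]
    field_simp
  simp only [e7, ← mul_sum, Fintype.sum_prod_type]
  rw [sum_const, sum_comm]
  have e8 := sum_le_card_nsmul univ _ _ fun x _ => hNsum x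
  simp only [card_univ, nsmul_eq_mul] at e8 ⊢
  have e9 : c * 2 ^ k / 2 ^ #U * (Fintype.card (Bits k) * ∑ x, ∑ t, (N t x : ℝ)) ≤
      c * 2 ^ k / 2 ^ #U * (Fintype.card (Bits k) * (Fintype.card (Fin n → Bool) *
        (Fintype.card T * (1 + 2 ^ #U * (2 : ℝ)⁻¹ ^ k)))) := by gcongr
  -- The summand 1 is cancelled by the `-1` in the χ²-divergence.
  have e10 : c * 2 ^ k / 2 ^ #U * (Fintype.card (Bits k) * (Fintype.card (Fin n → Bool) *
        (Fintype.card T * (1 + 2 ^ #U * (2 : ℝ)⁻¹ ^ k)))) = 2 ^ k / 2 ^ #U + 1 := by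
    rw [hc, inv_pow]
    simp only [Fintype.card_fun, Fintype.card_bool, Fintype.card_fin]
    push_cast
    field_simp
  linarith

/-- What becomes known about a uniform string `v.1`: the seed, the channel input outside `U`, and,
if there is an index set `S`, the string masked by the hash value of the input on `S`. -/
noncomputable def slotView {ℓ : ℕ} (F : TwoUniversalFamily ℓ k) (S : Option (Finset (Fin n)))
    (U : Finset (Fin n)) (v : Bits k × F.Seed × (Fin n → Bool)) :
    F.Seed × (Fin n → Bool) × Option (Bits k) :=
  (v.2.1, hideOn U v.2.2, S.map fun S => bxor v.1 (F.hash v.2.1 (restrict v.2.2 S ℓ)))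

lemma mutualInfo_slotView_le {ℓ : ℕ} (F : TwoUniversalFamily ℓ k) {S U : Finset (Fin n)}
    (hUS : U ⊆ S) (hS : #S = ℓ) :
    mutualInfo slotWeight (fun v => v.1) (slotView F (some S) U) ≤
      2 ^ k / 2 ^ #U / Real.log 2 :=
  mutualInfo_masked_le U (fun t x => F.hash t (restrict x S ℓ)) fun _ _ hne h =>
    F.two_universal _ _ fun hr => hne (restrict_injOn hUS hS h hr)

/-- Without an index set no masked string is published, so the view does not involve the string. -/
lemma mutualInfo_slotView_none {ℓ : ℕ} (F : TwoUniversalFamily ℓ k) (U : Finset (Fin n)) :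
    mutualInfo slotWeight (fun v => v.1) (slotView F none U) = 0 := by
  classical
  refine mutualInfo_eq_zero _ _ fun m y => ?_
  rw [prob_slotWeight_fst]
  have e1 := prob_prod (unif : Bits k → ℝ)
    (fun b : F.Seed × (Fin n → Bool) => unif b.1 * unif b.2)
  have e2 : ∀ m' : Bits k, unif m' = (2 : ℝ)⁻¹ ^ k := fun m' => by simp [unif]
  have e3 : (slotWeight : Bits k × F.Seed × (Fin n → Bool) → ℝ) =
    fun v => unif v.1 * (unif v.2.1 * unif v.2.2) := rfl
  rw [e3, e1, e1, sum_eq_single m]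
  · simp only [slotView, true_and, Option.map_none]
    rw [← sum_mul, sum_unif, one_mul, e2]
  · intro m' _ h
    simp [h, prob]
  · simp

lemma mutualInfo_slotView_le_length {ℓ : ℕ} (F : TwoUniversalFamily ℓ k)
    (S : Option (Finset (Fin n))) (U : Finset (Fin n)) :
    mutualInfo slotWeight (fun v => v.1) (slotView F S U) ≤ k :=
  mutualInfo_le_of_uniform slotWeight_nonneg sum_slotWeight _ _ k prob_slotWeight_fst

/-- Leftover hashing with side information that determines the index set. -/
lemma mutualInfo_side_slotView_le {A : Type*} [Fintype A] {wA : A → ℝ} (hw : ∀ a, 0 ≤ wA a)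
    (hA : ∑ a, wA a = 1) {ℓ : ℕ} (F : TwoUniversalFamily ℓ k)
    (S : A → Option (Finset (Fin n))) (U : A → Finset (Fin n))
    (hUS : ∀ a s, S a = some s → U a ⊆ s ∧ #s = ℓ) (bad : A → Prop) {ε : ℝ} (hε0 : 0 ≤ ε)
    (hε : ∀ a s, S a = some s → ¬ bad a → (2 : ℝ) ^ k / 2 ^ #(U a) ≤ ε) :
    mutualInfo (fun v : A × Bits k × F.Seed × (Fin n → Bool) => wA v.1 * slotWeight v.2)
      (fun v => v.2.1) (fun v => (v.1, slotView F (S v.1) (U v.1) v.2)) ≤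
      k * prob wA bad + ε / Real.log 2 := by
  classical
  have hlog : 0 < Real.log 2 := Real.log_pos one_lt_two
  rw [mutualInfo_prod hA (fun v : Bits k × F.Seed × (Fin n → Bool) => v.1)
    (fun a => slotView F (S a) (U a)), prob_eq_sum, mul_sum]
  rw [show ε / Real.log 2 = ∑ a, wA a * (ε / Real.log 2) by rw [← sum_mul, hA, one_mul],
    ← sum_add_distrib]
  refine sum_le_sum fun a _ => ?_
  have hε' : 0 ≤ wA a * (ε / Real.log 2) := mul_nonneg (hw a) (by positivity)
  -- Side information in `bad` costs the trivial `k` bits; otherwise hashing gives `ε`, or 0 after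
  -- an abort.
  by_cases hb : bad a
  · rw [if_pos hb, mul_comm (k : ℝ)]
    have := mul_le_mul_of_nonneg_left (mutualInfo_slotView_le_length F (S a) (U a)) (hw a)
    linarith
  · rw [if_neg hb, mul_zero, zero_add]
    refine mul_le_mul_of_nonneg_left ?_ (hw a)
    rcases hS : S a with _ | s
    · rw [mutualInfo_slotView_none]
      positivity
    · obtain ⟨h1, h2⟩ := hUS a s hS
      exact (mutualInfo_slotView_le F h1 h2).trans
        (div_le_div_of_nonneg_right (hε a s hS hb) hlog.le)

end Hashing

/-! ### Product weights and independence -/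

section Weights

variable {α β : Type*} [Fintype α] [Fintype β]

/-- Probability weights on a finite type. -/
structure IsProbWeight (w : α → ℝ) : Prop where
  nonneg : ∀ a, 0 ≤ w a
  sum_eq_one : ∑ a, w a = 1

lemma IsProbWeight.prod {f : α → ℝ} {g : β → ℝ} (hf : IsProbWeight f) (hg : IsProbWeight g) :
    IsProbWeight fun v : α × β => f v.1 * g v.2 where
  nonneg v := mul_nonneg (hf.nonneg _) (hg.nonneg _)
  sum_eq_one := by
    simp only [Fintype.sum_prod_type, ← mul_sum, hg.sum_eq_one, mul_one, hf.sum_eq_one]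

lemma isProbWeight_unif [Nonempty α] : IsProbWeight (unif : α → ℝ) :=
  ⟨unif_nonneg, sum_unif⟩

lemma isProbWeight_bernWeight {n : ℕ} {p : ℝ} (h0 : 0 ≤ p) (h1 : p ≤ 1) :
    IsProbWeight (bernWeight p : (Fin n → Bool) → ℝ) :=
  ⟨fun _ => prod_nonneg fun _ _ => bern_nonneg h0 h1 _, sum_bernWeight p⟩

lemma IsProbWeight.of_equiv {f : α → ℝ} {g : β → ℝ} (hg : IsProbWeight g) (φ : α ≃ β)
    (h : ∀ a, g (φ a) = f a) : IsProbWeight f where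
  nonneg a := h a ▸ hg.nonneg _
  sum_eq_one := by
    rw [← hg.sum_eq_one, ← φ.sum_comp]
    simp only [h]

lemma IsProbWeight.prob_prod_le {f : α → ℝ} {g : β → ℝ} (hf : IsProbWeight f)
    {A : α × β → Prop} {ε : ℝ} (h : ∀ a, prob g (fun b => A (a, b)) ≤ ε) :
    prob (fun v : α × β => f v.1 * g v.2) A ≤ ε := by
  rw [prob_prod]
  calc ∑ a, f a * prob g (fun b => A (a, b)) ≤ ∑ a, f a * ε :=
        sum_le_sum fun a _ => mul_le_mul_of_nonneg_left (h a) (hf.nonneg a)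
    _ = ε := by rw [← sum_mul, hf.sum_eq_one, one_mul]

lemma prob_prod_swap (f : α → ℝ) (g : β → ℝ) (A : α × β → Prop) :
    prob (fun v : α × β => f v.1 * g v.2) A =
      prob (fun v : β × α => g v.1 * f v.2) (fun v => A v.swap) :=
  prob_equiv (Equiv.prodComm α β) _ (fun _ => mul_comm _ _) A

lemma prob_unif_pi {m : ℕ} (A : Fin m → α → Prop) :
    prob (unif : (Fin m → α) → ℝ) (fun f => ∀ i, A i (f i)) = ∏ i, prob unif (A i) := by
  classical
  have h : ∀ i, prob (unif : α → ℝ) (A i) = 1 / Fintype.card α * #{a | A i a} :=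
    fun i => prob_const _ _
  have h' : prob (unif : (Fin m → α) → ℝ) (fun f => ∀ i, A i (f i)) =
    1 / Fintype.card (Fin m → α) * #{f : Fin m → α | ∀ i, A i (f i)} := prob_const _ _
  simp only [h, h']
  have h2 : ({f | ∀ i, A i (f i)} : Finset (Fin m → α)) = Fintype.piFinset fun i => {a | A i a} := by
    ext f
    simp
  rw [h2, Fintype.card_piFinset, prod_mul_distrib]
  simp

lemma prob_comp_eq_sum (w : α → ℝ) (g : α → β) (A : β → Prop) [DecidablePred A] :
    prob w (fun a => A (g a)) = ∑ b, if A b then prob w (fun a => g a = b) else 0 := by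
  classical
  have h : ∀ b, (if A b then prob w (fun a => g a = b) else 0) =
      ∑ a, if g a = b then (if A b then w a else 0) else 0 := by
    intro b
    rw [prob_eq_sum]
    split_ifs <;> simp
  simp only [h]
  rw [sum_comm, prob_eq_sum]
  simp

end Weights

/-! ### Random subsets drawn from tapes -/

section Sampling

variable {n : ℕ}

lemma SubsetSampler.prob_pick (s : SubsetSampler n) {E A : Finset (Fin n)} {m : ℕ}
    (hA : A ∈ E.powersetCard m) :
    prob unif (fun t => s.pick t E m = A) = 1 / (#E).choose m := by
  classical
  have h : prob unif (fun t => s.pick t E m = A) =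
    1 / Fintype.card s.Tape * #{t | s.pick t E m = A} := prob_const _ _
  rw [h, ← s.uniform E m A hA, Nat.card_eq_fintype_card, Fintype.card_subtype]
  ring

/-- The sampler axiom only prescribes probabilities of admissible sets. These already sum to 1 and
every tape has positive weight, so no tape can yield anything else. -/
lemma SubsetSampler.pick_mem (s : SubsetSampler n) {E : Finset (Fin n)} {m : ℕ} (hm : m ≤ #E)
    (t : s.Tape) : s.pick t E m ∈ E.powersetCard m := by
  classical
  have h1 : ∑ A ∈ E.powersetCard m, prob unif (fun t => s.pick t E m = A) = 1 := by
    rw [sum_congr rfl fun A hA => s.prob_pick hA, sum_const, card_powersetCard, nsmul_eq_mul]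
    have : ((#E).choose m : ℝ) ≠ 0 := by exact_mod_cast (Nat.choose_pos hm).ne'
    field_simp
  have h2 : ∑ A ∈ E.powersetCard m, prob unif (fun t => s.pick t E m = A) =
      ∑ t : s.Tape, if s.pick t E m ∈ E.powersetCard m then unif t else 0 := by
    simp only [prob_eq_sum]
    rw [sum_comm]
    simp
  have h3 : ∑ t : s.Tape, (unif t - if s.pick t E m ∈ E.powersetCard m then unif t else 0) = 0 := by
    rw [sum_sub_distrib, ← h2, h1, sum_unif, sub_self]
  rw [sum_eq_zero_iff_of_nonneg fun t _ => by split_ifs <;> simp [unif]] at h3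
  by_contra h
  have := h3 t (mem_univ _)
  simp [h, unif] at this

lemma SubsetSampler.mem_of_prob_pick_ne_zero (s : SubsetSampler n) {E A : Finset (Fin n)} {m : ℕ}
    (hm : m ≤ #E) (h : prob unif (fun t => s.pick t E m = A) ≠ 0) : A ∈ E.powersetCard m := by
  by_contra hA
  refine h (sum_eq_zero fun t _ => if_neg fun ht => hA ?_)
  exact ht ▸ s.pick_mem hm t

end Sampling

/-! ### The measure-preserving exchange of erased and received positions -/

section Flip

variable {n : ℕ}

/-- The erased positions, from the erasure indicators. -/
def erasures (e : Fin n → Bool) : Finset (Fin n) := univ.filter fun l => e l = true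

@[simp] lemma mem_erasures {e : Fin n → Bool} {l : Fin n} : l ∈ erasures e ↔ e l = true := by
  simp [erasures]

/-- Exchange erased and received positions within `C`. -/
def flipOn (C : Finset (Fin n)) (e : Fin n → Bool) : Fin n → Bool :=
  fun l => if l ∈ C then !e l else e l

lemma flipOn_flipOn (C : Finset (Fin n)) (e : Fin n → Bool) : flipOn C (flipOn C e) = e := by
  funext l
  by_cases h : l ∈ C <;> simp [flipOn, h]

variable {A B : Finset (Fin n)} {e : Fin n → Bool}

/-- On `A ∪ B` the factors `(1-p)^#A * p^#B` become `p^#A * (1-p)^#B`, the same since the sizes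
agree. -/
lemma bernWeight_flipOn (p : ℝ) (hA : ∀ l ∈ A, e l = false) (hB : ∀ l ∈ B, e l = true)
    (hAB : #A = #B) :
    bernWeight p (flipOn (A ∪ B) e) = bernWeight p e := by
  have hd : Disjoint A B := disjoint_left.2 fun l h h' => by simpa [hA l h] using hB l h'
  rw [bernWeight, bernWeight, ← prod_mul_prod_compl (A ∪ B), ← prod_mul_prod_compl (A ∪ B) fun l => bern p (e l),
    prod_union hd, prod_union hd]
  congr 1
  · rw [prod_congr rfl (g := fun _ => p) fun l hl => by simp [flipOn, hl, hA l hl, bern],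
      prod_congr rfl (s₁ := B) (g := fun _ => 1 - p) fun l hl => by
        simp [flipOn, hl, hB l hl, bern],
      prod_congr rfl (s₁ := A) (f := fun l => bern p (e l)) (g := fun _ => 1 - p) fun l hl => by
        simp [hA l hl, bern],
      prod_congr rfl (s₁ := B) (f := fun l => bern p (e l)) (g := fun _ => p) fun l hl => by
        simp [hB l hl, bern]]
    simp only [prod_const, hAB]
    ring
  · refine prod_congr rfl fun l hl => ?_
    rw [mem_compl] at hl
    simp [flipOn, hl]

/-- Within `R` the erasures lose `B` and gain `A`. This keeps the abort tests and the binomial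
coefficients of the samplers unchanged. -/
lemma card_inter_erasures_flipOn {R : Finset (Fin n)} (hAR : A ⊆ R) (hBR : B ⊆ R)
    (hA : ∀ l ∈ A, e l = false) (hB : ∀ l ∈ B, e l = true) (hAB : #A = #B) :
    #(R ∩ erasures (flipOn (A ∪ B) e)) = #(R ∩ erasures e) := by
  have h1 : R ∩ erasures (flipOn (A ∪ B) e) = ((R ∩ erasures e) \ B) ∪ A := by
    ext l
    have := @hAR l
    have := hA l
    have := hB l
    by_cases l ∈ A <;> by_cases l ∈ B <;> cases h : e l <;>
      simp_all [flipOn]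
  have h2 : B ⊆ R ∩ erasures e := fun l hl => by simp [hBR hl, hB l hl]
  have h3 : Disjoint ((R ∩ erasures e) \ B) A := disjoint_left.2 fun l h h' => by
    simp [hA l h'] at h
  rw [h1, card_union_of_disjoint h3, card_sdiff_of_subset h2, hAB]
  exact Nat.sub_add_cancel (card_le_card h2)

lemma card_sdiff_erasures_flipOn {R : Finset (Fin n)} (hAR : A ⊆ R) (hBR : B ⊆ R)
    (hA : ∀ l ∈ A, e l = false) (hB : ∀ l ∈ B, e l = true) (hAB : #A = #B) :
    #(R \ erasures (flipOn (A ∪ B) e)) = #(R \ erasures e) := by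
  have h1 := card_inter_add_card_sdiff R (erasures e)
  have h2 := card_inter_add_card_sdiff R (erasures (flipOn (A ∪ B) e))
  have h3 := card_inter_erasures_flipOn hAR hBR hA hB hAB
  omega

/-- Exchange of the two index sets `S z` (received) and `S (!z)` (erased). -/
lemma sum_bern_mul_bool_comm (p : ℝ) (S : Bool → Finset (Fin n)) (Q : Bool → (Fin n → Bool) → ℝ)
    (hQ : ∀ z e, Q z e ≠ 0 → (∀ l ∈ S z, e l = false) ∧ (∀ l ∈ S (!z), e l = true) ∧
      #(S z) = #(S (!z)) ∧ Q (!z) (flipOn (S z ∪ S (!z)) e) = Q z e) :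
    ∑ e : Fin n → Bool, bernWeight p e * Q true e =
      ∑ e : Fin n → Bool, bernWeight p e * Q false e := by
  have hinv : Function.Involutive (flipOn (S true ∪ S false)) := flipOn_flipOn _
  rw [← Equiv.sum_comp hinv.toPerm fun e => bernWeight p e * Q false e]
  refine sum_congr rfl fun e _ => ?_
  simp only [Function.Involutive.coe_toPerm]
  by_cases h : Q true e = 0
  -- If the flipped pattern had nonzero `Q false`, the hypothesis at `false` would flip back to `e`
  -- and make `Q true e` nonzero.
  · rw [h, mul_zero]
    by_contra hne
    have hne' : Q false (flipOn (S true ∪ S false) e) ≠ 0 := fun h0 => hne (by rw [h0, mul_zero])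
    obtain ⟨-, -, -, h4⟩ := hQ _ _ hne'
    simp only [Bool.not_false] at h4
    rw [union_comm (S false), flipOn_flipOn, h] at h4
    exact hne' h4.symm
  · obtain ⟨h1, h2, h3, h4⟩ := hQ _ _ h
    simp only [Bool.not_true] at h2 h3 h4
    rw [h4, bernWeight_flipOn p h1 h2 h3]

end Flip

/-! ### Announcements and their independence of the choice bit -/

section Announcements

variable {P : Params} {n : ℕ}

/-- Bob-1's announcement as a function of the randomness it depends on. -/
noncomputable def announce₁ (D : Tools P n) (z : Bool) (e : Fin n → Bool)
    (rb : Fin 3 → D.sampler₁.Tape) : Option ((Bool → Finset (Fin n)) × Finset (Fin n)) :=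
  let E := erasures e
  let good := D.sampler₁.pick (rb 0) Eᶜ (P.len₁ n)
  let bad := D.sampler₁.pick (rb 1) E (P.len₁ n)
  let left := D.sampler₁.pick (rb 2) (E \ bad) (P.lenLeft n)
  if P.len₁ n ≤ Eᶜ.card ∧ P.len₁ n + P.lenLeft n ≤ E.card then
    some (fun j => if j = z then good else bad, left)
  else none

/-- Bob-2's announcement as a function of the randomness it depends on. -/
noncomputable def announce₂ (D : Tools P n) (S' : Finset (Fin n)) (z : Bool) (e : Fin n → Bool)
    (rb : Fin 2 → D.sampler₂.Tape) : Option (Bool → Finset (Fin n)) :=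
  let E := S' ∩ erasures e
  let G := S' \ erasures e
  let good := D.sampler₂.pick (rb 0) G (P.len₂ n)
  let bad := D.sampler₂.pick (rb 1) E (P.len₂ n)
  if S' ≠ ∅ ∧ P.len₂ n ≤ G.card ∧ P.len₂ n ≤ E.card then
    some fun j => if j = z then good else bad
  else none

lemma erased_y₁ {D : Tools P n} (ω : Outcome D) : erased ω.y₁ = erasures ω.e₁ := by
  ext l
  simp [erased, Outcome.y₁]

lemma erased_y₂ {D : Tools P n} (ω : Outcome D) : erased ω.y₂ = erasures ω.e₂ := by
  ext l
  simp [erased, Outcome.y₂]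

lemma bob₁_eq_announce₁ {D : Tools P n} (ω : Outcome D) :
    ω.bob₁ = announce₁ D ω.z₁ ω.e₁ ω.rb₁ := by
  rw [Outcome.bob₁, announce₁, erased_y₁]

lemma bob₂_eq_announce₂ {D : Tools P n} (ω : Outcome D) (S' : Finset (Fin n)) :
    ω.bob₂ S' = announce₂ D S' ω.z₂ ω.e₂ ω.rb₂ := by
  rw [Outcome.bob₂, announce₂, erased_y₂]

variable {D : Tools P n}

/-- What Bob-1's announcement looks like when he does not abort. -/
structure IsAnnouncement₁ (P : Params) (z : Bool) (e : Fin n → Bool)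
    (s : (Bool → Finset (Fin n)) × Finset (Fin n)) : Prop where
  good : ∀ l ∈ s.1 z, e l = false
  bad : ∀ l ∈ s.1 (!z), e l = true
  left : ∀ l ∈ s.2, e l = true
  disjoint_bad_left : Disjoint (s.1 (!z)) s.2
  card : ∀ b, #(s.1 b) = P.len₁ n
  card_left : #s.2 = P.lenLeft n

structure IsAnnouncement₂ (P : Params) (S' : Finset (Fin n)) (z : Bool) (e : Fin n → Bool)
    (S : Bool → Finset (Fin n)) : Prop where
  good : ∀ l ∈ S z, e l = false
  bad : ∀ l ∈ S (!z), e l = true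
  subset : ∀ b, S b ⊆ S'
  card : ∀ b, #(S b) = P.len₂ n

lemma forall_bool_of (z : Bool) {A : Bool → Prop} (h : A z) (h' : A (!z)) : ∀ b, A b := by
  intro b
  rcases Bool.eq_or_eq_not b z with rfl | rfl <;> assumption

lemma announce₁_spec {z : Bool} {e : Fin n → Bool} {rb : Fin 3 → D.sampler₁.Tape}
    {s : (Bool → Finset (Fin n)) × Finset (Fin n)} (h : announce₁ D z e rb = some s) :
    IsAnnouncement₁ P z e s := by
  simp only [announce₁] at h
  split_ifs at h with hc
  have hz : (!z) ≠ z := by simp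
  simp only [Option.some.injEq] at h
  subst h
  have h1 := mem_powersetCard.1 (D.sampler₁.pick_mem hc.1 (rb 0))
  have h2 := mem_powersetCard.1 (D.sampler₁.pick_mem (le_of_add_le_left hc.2) (rb 1))
  have h3 := mem_powersetCard.1 (D.sampler₁.pick_mem
    (E := erasures e \ D.sampler₁.pick (rb 1) (erasures e) (P.len₁ n)) (m := P.lenLeft n)
    (by rw [card_sdiff_of_subset h2.1, h2.2]; omega) (rb 2))
  refine ⟨fun l hl => ?_, fun l hl => ?_, fun l hl => ?_, ?_, forall_bool_of z ?_ ?_, h3.2⟩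
  · simp only [if_true] at hl
    simpa using h1.1 hl
  · simp only [if_neg hz] at hl
    simpa using h2.1 hl
  · exact mem_erasures.1 (mem_sdiff.1 (h3.1 hl)).1
  · simp only [if_neg hz]
    exact (disjoint_of_subset_left h3.1 sdiff_disjoint).symm
  · simpa using h1.2
  · simpa [hz] using h2.2

lemma announce₂_spec {S' : Finset (Fin n)} {z : Bool} {e : Fin n → Bool}
    {rb : Fin 2 → D.sampler₂.Tape} {S : Bool → Finset (Fin n)}
    (h : announce₂ D S' z e rb = some S) : IsAnnouncement₂ P S' z e S := by
  simp only [announce₂] at h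
  split_ifs at h with hc
  have hz : (!z) ≠ z := by simp
  simp only [Option.some.injEq] at h
  subst h
  have h1 := mem_powersetCard.1 (D.sampler₂.pick_mem hc.2.1 (rb 0))
  have h2 := mem_powersetCard.1 (D.sampler₂.pick_mem hc.2.2 (rb 1))
  refine ⟨fun l hl => ?_, fun l hl => ?_, forall_bool_of z ?_ ?_, forall_bool_of z ?_ ?_⟩
  · simp only [if_true] at hl
    simpa using (mem_sdiff.1 (h1.1 hl)).2
  · simp only [if_neg hz] at hl
    simpa using (mem_inter.1 (h2.1 hl)).2
  · simpa using h1.1.trans sdiff_subset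
  · simpa [hz] using h2.1.trans inter_subset_left
  · simpa using h1.2
  · simpa [hz] using h2.2

lemma IsAnnouncement₁.disjoint {z : Bool} {e : Fin n → Bool}
    {s : (Bool → Finset (Fin n)) × Finset (Fin n)} (h : IsAnnouncement₁ P z e s) (b : Bool) :
    Disjoint (s.1 b) (s.1 (!b)) := by
  have : Disjoint (s.1 z) (s.1 (!z)) := disjoint_left.2 fun l hl hl' => by
    simpa [h.good l hl] using h.bad l hl'
  revert b
  refine forall_bool_of z this ?_
  rw [Bool.not_not]
  exact this.symm

/-- This separates the phases: no channel bit enters masks of both receivers. The good set is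
received while `S'` is erased, and `S'` avoids the bad set by construction. -/
lemma IsAnnouncement₁.disjoint_fst_snd {z : Bool} {e : Fin n → Bool}
    {s : (Bool → Finset (Fin n)) × Finset (Fin n)} (h : IsAnnouncement₁ P z e s) :
    ∀ b, Disjoint (s.1 b) s.2 := by
  refine forall_bool_of z (disjoint_left.2 fun l hl hl' => ?_) h.disjoint_bad_left
  simpa [h.good l hl] using h.left l hl'

lemma IsAnnouncement₂.disjoint {S' : Finset (Fin n)} {z : Bool} {e : Fin n → Bool}
    {S : Bool → Finset (Fin n)} (h : IsAnnouncement₂ P S' z e S) (b : Bool) :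
    Disjoint (S b) (S (!b)) := by
  have : Disjoint (S z) (S (!z)) := disjoint_left.2 fun l hl hl' => by
    simpa [h.good l hl] using h.bad l hl'
  revert b
  refine forall_bool_of z this ?_
  rw [Bool.not_not]
  exact this.symm

lemma ite_eq_fun_iff {α : Type*} {z : Bool} {a b : α} {S : Bool → α} :
    (fun j => if j = z then a else b) = S ↔ a = S z ∧ b = S (!z) := by
  constructor
  · rintro rfl
    simp
  · rintro ⟨rfl, rfl⟩
    funext j
    rcases Bool.eq_or_eq_not j z with rfl | rfl <;> simp

/-- The law of Bob-1's announcement does not depend on his choice bit. -/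
lemma prob_announce₁_bool_comm (p : ℝ) (o : Option ((Bool → Finset (Fin n)) × Finset (Fin n))) :
    prob (fun v : (Fin n → Bool) × (Fin 3 → D.sampler₁.Tape) =>
        bernWeight p v.1 * unif v.2) (fun v => announce₁ D true v.1 v.2 = o) =
      prob (fun v : (Fin n → Bool) × (Fin 3 → D.sampler₁.Tape) =>
        bernWeight p v.1 * unif v.2) (fun v => announce₁ D false v.1 v.2 = o) := by
  rw [prob_prod, prob_prod]
  rcases o with _ | ⟨S, S'⟩
  · refine sum_congr rfl fun e _ => ?_
    congr 1
    refine prob_congr fun rb => ?_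
    simp only [announce₁]
    split_ifs <;> simp
  -- The three sets use separate tapes. The third draw depends on the second only through its
  -- result, which the event fixes to `S (!z)`, so the probability factors.
  · have key : ∀ z e, prob (unif : (Fin 3 → D.sampler₁.Tape) → ℝ)
        (fun rb => announce₁ D z e rb = some (S, S')) =
        if P.len₁ n ≤ #(erasures e)ᶜ ∧ P.len₁ n + P.lenLeft n ≤ #(erasures e) then
          prob unif (fun t => D.sampler₁.pick t (erasures e)ᶜ (P.len₁ n) = S z) *
          prob unif (fun t => D.sampler₁.pick t (erasures e) (P.len₁ n) = S (!z)) *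
          prob unif (fun t => D.sampler₁.pick t (erasures e \ S (!z)) (P.lenLeft n) = S')
        else 0 := by
      intro z e
      split_ifs with hc
      · have := prob_unif_pi ![fun t => D.sampler₁.pick t (erasures e)ᶜ (P.len₁ n) = S z,
          fun t => D.sampler₁.pick t (erasures e) (P.len₁ n) = S (!z),
          fun t => D.sampler₁.pick t (erasures e \ S (!z)) (P.lenLeft n) = S']
        rw [Fin.prod_univ_three] at this
        refine Eq.trans (prob_congr fun rb => ?_) this
        simp only [announce₁, if_pos hc, Option.some.injEq, Prod.mk.injEq, ite_eq_fun_iff,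
          Fin.forall_fin_succ, Fin.forall_fin_zero, and_true]
        simp only [Matrix.cons_val_zero, Fin.succ_zero_eq_one,
          Fin.succ_one_eq_two]
        constructor
        · rintro ⟨⟨h1, h2⟩, h3⟩
          exact ⟨h1, h2, by rw [← h2]; exact h3⟩
        · rintro ⟨h1, h2, h3⟩
          exact ⟨⟨h1, h2⟩, by rw [h2]; exact h3⟩
      · simp [announce₁, hc, prob]
    refine sum_bern_mul_bool_comm p S (fun z e => prob unif fun rb => announce₁ D z e rb = some (S, S'))
      fun z e h => ?_
    simp only [key] at h ⊢
    rw [ite_ne_right_iff] at h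
    obtain ⟨hc, h⟩ := h
    have m1 := D.sampler₁.mem_of_prob_pick_ne_zero hc.1 (left_ne_zero_of_mul (left_ne_zero_of_mul h))
    have m2 := D.sampler₁.mem_of_prob_pick_ne_zero (le_of_add_le_left hc.2)
      (right_ne_zero_of_mul (left_ne_zero_of_mul h))
    have p1 := mem_powersetCard.1 m1
    have p2 := mem_powersetCard.1 m2
    have m3 := D.sampler₁.mem_of_prob_pick_ne_zero
      (by rw [card_sdiff_of_subset p2.1, p2.2]; omega) (right_ne_zero_of_mul h)
    have p3 := mem_powersetCard.1 m3
    have hA : ∀ l ∈ S z, e l = false := fun l hl => by simpa using p1.1 hl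
    have hB : ∀ l ∈ S (!z), e l = true := fun l hl => by simpa using p2.1 hl
    have hAB : #(S z) = #(S (!z)) := by rw [p1.2, p2.2]
    refine ⟨hA, hB, hAB, ?_⟩
    have c1 : #(erasures (flipOn (S z ∪ S (!z)) e)) = #(erasures e) := by
      simpa using card_inter_erasures_flipOn (subset_univ _) (subset_univ _) hA hB hAB
    have c2 : #(erasures (flipOn (S z ∪ S (!z)) e))ᶜ = #(erasures e)ᶜ := by
      rw [card_compl, card_compl, c1]
    have s1 : S z ⊆ erasures (flipOn (S z ∪ S (!z)) e) := fun l hl => by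
      simp [flipOn, hl, hA l hl]
    have s2 : S (!z) ⊆ (erasures (flipOn (S z ∪ S (!z)) e))ᶜ := fun l hl => by
      simp [flipOn, hl, hB l hl]
    -- After the flip `S z` is the erased set, and `S'` is still erased and disjoint from it: a
    -- legitimate leftover draw for the opposite bit.
    have s3 : S' ⊆ erasures (flipOn (S z ∪ S (!z)) e) \ S z := fun l hl => by
      have h3 := p3.1 hl
      rw [Finset.mem_sdiff, mem_erasures] at h3
      have h4 : l ∉ S z := fun h4 => by simp [hA l h4] at h3
      simp [flipOn, h3, h4]
    -- Each factor is the reciprocal of a binomial coefficient in cardinalities that the flip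
    -- preserves.
    rw [if_pos (by rwa [c1, c2]), if_pos hc, Bool.not_not, D.sampler₁.prob_pick m1,
      D.sampler₁.prob_pick m2, D.sampler₁.prob_pick m3,
      D.sampler₁.prob_pick (mem_powersetCard.2 ⟨s1, p1.2⟩),
      D.sampler₁.prob_pick (mem_powersetCard.2 ⟨s2, p2.2⟩),
      D.sampler₁.prob_pick (mem_powersetCard.2 ⟨s3, p3.2⟩), c2, c1, card_sdiff_of_subset s1,
      card_sdiff_of_subset p2.1, c1, hAB]

/-- The law of Bob-2's announcement does not depend on his choice bit. -/
lemma prob_announce₂_bool_comm (p : ℝ) (S' : Finset (Fin n)) (o : Option (Bool → Finset (Fin n))) :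
    prob (fun v : (Fin n → Bool) × (Fin 2 → D.sampler₂.Tape) =>
        bernWeight p v.1 * unif v.2) (fun v => announce₂ D S' true v.1 v.2 = o) =
      prob (fun v : (Fin n → Bool) × (Fin 2 → D.sampler₂.Tape) =>
        bernWeight p v.1 * unif v.2) (fun v => announce₂ D S' false v.1 v.2 = o) := by
  rw [prob_prod, prob_prod]
  rcases o with _ | S
  · refine sum_congr rfl fun e _ => ?_
    congr 1
    refine prob_congr fun rb => ?_
    simp only [announce₂]
    split_ifs <;> simp
  · have key : ∀ z e, prob (unif : (Fin 2 → D.sampler₂.Tape) → ℝ)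
        (fun rb => announce₂ D S' z e rb = some S) =
        if S' ≠ ∅ ∧ P.len₂ n ≤ #(S' \ erasures e) ∧ P.len₂ n ≤ #(S' ∩ erasures e) then
          prob unif (fun t => D.sampler₂.pick t (S' \ erasures e) (P.len₂ n) = S z) *
          prob unif (fun t => D.sampler₂.pick t (S' ∩ erasures e) (P.len₂ n) = S (!z))
        else 0 := by
      intro z e
      split_ifs with hc
      · have := prob_unif_pi ![fun t => D.sampler₂.pick t (S' \ erasures e) (P.len₂ n) = S z,
          fun t => D.sampler₂.pick t (S' ∩ erasures e) (P.len₂ n) = S (!z)]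
        rw [Fin.prod_univ_two] at this
        refine Eq.trans (prob_congr fun rb => ?_) this
        simp only [announce₂, if_pos hc, Option.some.injEq, ite_eq_fun_iff,
          Fin.forall_fin_succ, Fin.forall_fin_zero, and_true]
        simp only [Matrix.cons_val_zero, Fin.succ_zero_eq_one, Matrix.cons_val_one]
      · simp [announce₂, hc, prob]
    refine sum_bern_mul_bool_comm p S (fun z e => prob unif fun rb => announce₂ D S' z e rb = some S)
      fun z e h => ?_
    simp only [key] at h ⊢
    rw [ite_ne_right_iff] at h
    obtain ⟨hc, h⟩ := h
    have m1 := D.sampler₂.mem_of_prob_pick_ne_zero hc.2.1 (left_ne_zero_of_mul h)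
    have m2 := D.sampler₂.mem_of_prob_pick_ne_zero hc.2.2 (right_ne_zero_of_mul h)
    have p1 := mem_powersetCard.1 m1
    have p2 := mem_powersetCard.1 m2
    have hA : ∀ l ∈ S z, e l = false := fun l hl => by simpa using (mem_sdiff.1 (p1.1 hl)).2
    have hB : ∀ l ∈ S (!z), e l = true := fun l hl => by simpa using (mem_inter.1 (p2.1 hl)).2
    have hAB : #(S z) = #(S (!z)) := by rw [p1.2, p2.2]
    have r1 : S z ⊆ S' := p1.1.trans sdiff_subset
    have r2 : S (!z) ⊆ S' := p2.1.trans inter_subset_left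
    refine ⟨hA, hB, hAB, ?_⟩
    -- The flip takes place inside `S'`, so the counts of erased and received positions in `S'` are
    -- both preserved.
    have c1 := card_inter_erasures_flipOn r1 r2 hA hB hAB
    have c2 := card_sdiff_erasures_flipOn r1 r2 hA hB hAB
    have s1 : S z ⊆ S' ∩ erasures (flipOn (S z ∪ S (!z)) e) := fun l hl => by
      simp [flipOn, hl, hA l hl, r1 hl]
    have s2 : S (!z) ⊆ S' \ erasures (flipOn (S z ∪ S (!z)) e) := fun l hl => by
      simp [flipOn, hl, hB l hl, r2 hl]
    rw [if_pos (by rwa [c1, c2]), if_pos hc, Bool.not_not, D.sampler₂.prob_pick m1,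
      D.sampler₂.prob_pick m2, D.sampler₂.prob_pick (mem_powersetCard.2 ⟨s1, p1.2⟩),
      D.sampler₂.prob_pick (mem_powersetCard.2 ⟨s2, p2.2⟩), c2, c1]

end Announcements

/-! ### Factorisations of the joint law; the choice bits -/

section Protocol

variable {P : Params} {n : ℕ}

/-- Separation of the choice bit, the erasures and the local randomness of Bob-1. -/
def splitBob₁ (D : Tools P n) : Outcome D ≃
    ((Bool → Bits (P.k₁ n)) × (Bool → Bits (P.k₂ n)) × Bool × (Fin n → Bool) × (Fin n → Bool) ×
      (Bool → D.hash₁.Seed) × (Bool → D.hash₂.Seed) × (Fin 2 → D.sampler₂.Tape)) ×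
    Bool × (Fin n → Bool) × (Fin 3 → D.sampler₁.Tape) where
  toFun ω := ((ω.m₁, ω.m₂, ω.z₂, ω.x, ω.e₂, ω.t₁, ω.t₂, ω.rb₂), ω.z₁, ω.e₁, ω.rb₁)
  invFun v := ⟨v.1.1, v.1.2.1, v.2.1, v.1.2.2.1, v.1.2.2.2.1, v.2.2.1, v.1.2.2.2.2.1,
    v.1.2.2.2.2.2.1, v.1.2.2.2.2.2.2.1, v.2.2.2, v.1.2.2.2.2.2.2.2⟩
  left_inv _ := rfl
  right_inv _ := rfl

/-- Separation of the choice bit, the erasures and the local randomness of Bob-2. -/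
def splitBob₂ (D : Tools P n) : Outcome D ≃
    ((Bool → Bits (P.k₁ n)) × (Bool → Bits (P.k₂ n)) × Bool × (Fin n → Bool) × (Fin n → Bool) ×
      (Bool → D.hash₁.Seed) × (Bool → D.hash₂.Seed) × (Fin 3 → D.sampler₁.Tape)) ×
    Bool × (Fin n → Bool) × (Fin 2 → D.sampler₂.Tape) where
  toFun ω := ((ω.m₁, ω.m₂, ω.z₁, ω.x, ω.e₁, ω.t₁, ω.t₂, ω.rb₁), ω.z₂, ω.e₂, ω.rb₂)
  invFun v := ⟨v.1.1, v.1.2.1, v.1.2.2.1, v.2.1, v.1.2.2.2.1, v.1.2.2.2.2.1, v.2.2.1,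
    v.1.2.2.2.2.2.1, v.1.2.2.2.2.2.2.1, v.1.2.2.2.2.2.2.2, v.2.2.2⟩
  left_inv _ := rfl
  right_inv _ := rfl

/-- The randomness that governs the choice of the index sets. -/
abbrev SetRandomness (D : Tools P n) : Type :=
  Bool × Bool × (Fin n → Bool) × (Fin n → Bool) × (Fin 3 → D.sampler₁.Tape) ×
    (Fin 2 → D.sampler₂.Tape)

/-- The randomness of an outcome that governs the choice of the index sets. -/
def Outcome.setRandomness {D : Tools P n} (ω : Outcome D) : SetRandomness D :=
  (ω.z₁, ω.z₂, ω.e₁, ω.e₂, ω.rb₁, ω.rb₂)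

/-- A pair of values, in the order prescribed by a bit. -/
def orderedPair {α : Type*} (j : Bool) (a b : α) : Bool → α := fun i => if i = j then a else b

@[simp] lemma orderedPair_self {α : Type*} (j : Bool) (a b : α) : orderedPair j a b j = a := by
  simp [orderedPair]

@[simp] lemma orderedPair_not {α : Type*} (j : Bool) (a b : α) : orderedPair j a b (!j) = b := by
  simp [orderedPair]

@[simp] lemma orderedPair_eta {α : Type*} (j : Bool) (f : Bool → α) :
    orderedPair j (f j) (f (!j)) = f :=
  ite_eq_fun_iff.2 ⟨rfl, rfl⟩

/-- Separation of Bob-1's string with label `j`, its seed, and the channel input. -/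
def splitSlot₁ (D : Tools P n) (j : SetRandomness D → Bool) : Outcome D ≃
    (SetRandomness D × Bits (P.k₁ n) × D.hash₁.Seed × (Bool → Bits (P.k₂ n)) ×
      (Bool → D.hash₂.Seed)) × Bits (P.k₁ n) × D.hash₁.Seed × (Fin n → Bool) where
  toFun ω := ((ω.setRandomness, ω.m₁ (!j ω.setRandomness), ω.t₁ (!j ω.setRandomness), ω.m₂, ω.t₂),
    ω.m₁ (j ω.setRandomness), ω.t₁ (j ω.setRandomness), ω.x)
  invFun v := ⟨orderedPair (j v.1.1) v.2.1 v.1.2.1, v.1.2.2.2.1, v.1.1.1, v.1.1.2.1, v.2.2.2,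
    v.1.1.2.2.1, v.1.1.2.2.2.1, orderedPair (j v.1.1) v.2.2.1 v.1.2.2.1, v.1.2.2.2.2,
    v.1.1.2.2.2.2.1, v.1.1.2.2.2.2.2⟩
  left_inv ω := by simp [Outcome.setRandomness]
  right_inv v := by simp [Outcome.setRandomness]

/-- Separation of Bob-2's string with label `j`, its seed, and the channel input. -/
def splitSlot₂ (D : Tools P n) (j : SetRandomness D → Bool) : Outcome D ≃
    (SetRandomness D × Bits (P.k₂ n) × D.hash₂.Seed × (Bool → Bits (P.k₁ n)) ×
      (Bool → D.hash₁.Seed)) × Bits (P.k₂ n) × D.hash₂.Seed × (Fin n → Bool) where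
  toFun ω := ((ω.setRandomness, ω.m₂ (!j ω.setRandomness), ω.t₂ (!j ω.setRandomness), ω.m₁, ω.t₁),
    ω.m₂ (j ω.setRandomness), ω.t₂ (j ω.setRandomness), ω.x)
  invFun v := ⟨v.1.2.2.2.1, orderedPair (j v.1.1) v.2.1 v.1.2.1, v.1.1.1, v.1.1.2.1, v.2.2.2,
    v.1.1.2.2.1, v.1.1.2.2.2.1, v.1.2.2.2.2, orderedPair (j v.1.1) v.2.2.1 v.1.2.2.1,
    v.1.1.2.2.2.2.1, v.1.1.2.2.2.2.2⟩
  left_inv ω := by simp [Outcome.setRandomness]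
  right_inv v := by simp [Outcome.setRandomness]

/-- Uniform weights are constant, so `a` and `b` are arbitrary and need not be values of `f`. -/
lemma unif_bool_fun {α : Type*} [Fintype α] (f : Bool → α) (a b : α) :
    unif f = unif a * unif b := by
  simp [unif, pow_two]

/-- The joint law of two independent random variables. -/
def prodWeight {α β : Type*} (f : α → ℝ) (g : β → ℝ) (v : α × β) : ℝ := f v.1 * g v.2

lemma IsProbWeight.prodWeight {α β : Type*} [Fintype α] [Fintype β] {f : α → ℝ} {g : β → ℝ}
    (hf : IsProbWeight f) (hg : IsProbWeight g) : IsProbWeight (prodWeight f g) := hf.prod hg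

/-- The law of the components of an outcome other than those of one receiver. -/
noncomputable def restWeight (p : ℝ) {T : Type*} [Fintype T] (D : Tools P n) :
    (Bool → Bits (P.k₁ n)) × (Bool → Bits (P.k₂ n)) × Bool × (Fin n → Bool) × (Fin n → Bool) ×
      (Bool → D.hash₁.Seed) × (Bool → D.hash₂.Seed) × T → ℝ :=
  prodWeight unif (prodWeight unif (prodWeight unif (prodWeight unif (prodWeight (bernWeight p)
    (prodWeight unif (prodWeight unif unif))))))

/-- The law of the choice bit, the erasures and the local randomness of a receiver. -/
noncomputable def bobWeight (p : ℝ) {T : Type*} [Fintype T] : Bool × (Fin n → Bool) × T → ℝ :=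
  prodWeight unif (prodWeight (bernWeight p) unif)

lemma isProbWeight_restWeight {p : ℝ} (h0 : 0 ≤ p) (h1 : p ≤ 1) {T : Type*} [Fintype T] [Nonempty T]
    (D : Tools P n) : IsProbWeight (restWeight p D (T := T)) :=
  isProbWeight_unif.prodWeight (isProbWeight_unif.prodWeight (isProbWeight_unif.prodWeight
    (isProbWeight_unif.prodWeight ((isProbWeight_bernWeight h0 h1).prodWeight
      (isProbWeight_unif.prodWeight (isProbWeight_unif.prodWeight isProbWeight_unif))))))

lemma isProbWeight_bobWeight {p : ℝ} (h0 : 0 ≤ p) (h1 : p ≤ 1) {T : Type*} [Fintype T]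
    [Nonempty T] : IsProbWeight (bobWeight p : Bool × (Fin n → Bool) × T → ℝ) :=
  isProbWeight_unif.prodWeight ((isProbWeight_bernWeight h0 h1).prodWeight isProbWeight_unif)

/-- The law of the randomness that governs the choice of the index sets. -/
noncomputable def setWeight (D : Tools P n) : SetRandomness D → ℝ :=
  prodWeight unif (prodWeight unif (prodWeight (bernWeight P.p₁) (prodWeight (bernWeight P.p₂)
    (prodWeight unif unif))))

/-- The law of everything but one string, its seed and the channel input. -/
noncomputable def sideWeight (D : Tools P n) {α β γ δ : Type*} [Fintype α] [Fintype β] [Fintype γ]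
    [Fintype δ] : SetRandomness D × α × β × γ × δ → ℝ :=
  prodWeight (setWeight D) (prodWeight unif (prodWeight unif (prodWeight unif unif)))

lemma isProbWeight_sideWeight (hP : P.Admissible) (D : Tools P n) {α β γ δ : Type*} [Fintype α]
    [Fintype β] [Fintype γ] [Fintype δ] [Nonempty α] [Nonempty β] [Nonempty γ] [Nonempty δ] :
    IsProbWeight (sideWeight D : SetRandomness D × α × β × γ × δ → ℝ) := by
  refine IsProbWeight.prodWeight ?_ (isProbWeight_unif.prodWeight (isProbWeight_unif.prodWeight
    (isProbWeight_unif.prodWeight isProbWeight_unif)))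
  exact isProbWeight_unif.prodWeight (isProbWeight_unif.prodWeight
    ((isProbWeight_bernWeight hP.p₁_nonneg hP.p₁_le_one).prodWeight
    ((isProbWeight_bernWeight hP.p₂_nonneg hP.p₂_le_one).prodWeight
    (isProbWeight_unif.prodWeight isProbWeight_unif))))

variable {D : Tools P n}

lemma splitBob₁_law (ω : Outcome D) :
    restWeight P.p₂ D (splitBob₁ D ω).1 * bobWeight P.p₁ (splitBob₁ D ω).2 = ω.law := by
  simp only [restWeight, bobWeight, prodWeight, splitBob₁, Outcome.law, Equiv.coe_fn_mk, bernWeight]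
  ring

lemma splitBob₂_law (ω : Outcome D) :
    restWeight P.p₁ D (splitBob₂ D ω).1 * bobWeight P.p₂ (splitBob₂ D ω).2 = ω.law := by
  simp only [restWeight, bobWeight, prodWeight, splitBob₂, Outcome.law, Equiv.coe_fn_mk, bernWeight]
  ring

lemma splitSlot₁_law (j : SetRandomness D → Bool) (ω : Outcome D) :
    sideWeight D (splitSlot₁ D j ω).1 * slotWeight (splitSlot₁ D j ω).2 = ω.law := by
  simp only [sideWeight, setWeight, slotWeight, prodWeight, splitSlot₁, Outcome.law,
    Equiv.coe_fn_mk, bernWeight, Outcome.setRandomness]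
  rw [unif_bool_fun ω.m₁ (ω.m₁ (j ω.setRandomness)) (ω.m₁ (!j ω.setRandomness)),
    unif_bool_fun ω.t₁ (ω.t₁ (j ω.setRandomness)) (ω.t₁ (!j ω.setRandomness))]
  simp only [Outcome.setRandomness]
  ring

lemma splitSlot₂_law (j : SetRandomness D → Bool) (ω : Outcome D) :
    sideWeight D (splitSlot₂ D j ω).1 * slotWeight (splitSlot₂ D j ω).2 = ω.law := by
  simp only [sideWeight, setWeight, slotWeight, prodWeight, splitSlot₂, Outcome.law,
    Equiv.coe_fn_mk, bernWeight, Outcome.setRandomness]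
  rw [unif_bool_fun ω.m₂ (ω.m₂ (j ω.setRandomness)) (ω.m₂ (!j ω.setRandomness)),
    unif_bool_fun ω.t₂ (ω.t₂ (j ω.setRandomness)) (ω.t₂ (!j ω.setRandomness))]
  simp only [Outcome.setRandomness]
  ring

lemma isProbWeight_law (hP : P.Admissible) : IsProbWeight (Outcome.law (D := D)) :=
  ((isProbWeight_restWeight hP.p₂_nonneg hP.p₂_le_one D).prod
    (isProbWeight_bobWeight hP.p₁_nonneg hP.p₁_le_one)).of_equiv (splitBob₁ D) splitBob₁_law

/-! ### Secrecy of the choice bits -/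

/-- A uniform bit `Z`, of which only an announcement `g Z V` with a law that does not depend on
`Z` becomes known, is perfectly hidden. -/
lemma mutualInfo_announcement_eq_zero {R V γ β : Type*} [Fintype R] [Fintype V] [Fintype γ]
    {f : R → ℝ} {h : V → ℝ} (hf : IsProbWeight f) (hh : IsProbWeight h) (g : R → Bool → V → γ)
    (hg : ∀ r c, prob h (fun v => g r true v = c) = prob h (fun v => g r false v = c))
    (Y : R → γ → β) :
    mutualInfo (fun a : R × Bool × V => f a.1 * prodWeight unif h a.2) (fun a => a.2.1)
      (fun a => Y a.1 (g a.1 a.2.1 a.2.2)) = 0 := by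
  classical
  have key : ∀ (z : Bool) (A : R × Bool × V → Prop),
      prob (fun a : R × Bool × V => f a.1 * prodWeight unif h a.2) (fun a => a.2.1 = z ∧ A a) =
        ∑ r, f r * (1 / 2 * prob h (fun v => A (r, z, v))) := by
    intro z A
    rw [prob_prod]
    refine sum_congr rfl fun r _ => ?_
    congr 1
    refine (prob_prod unif h _).trans ?_
    rw [Fintype.sum_bool]
    cases z <;> simp [unif, prob]
  refine mutualInfo_bit_eq_zero (hf.prod (isProbWeight_unif.prodWeight hh)).sum_eq_one _ _
    (fun y => ?_) ?_
  · rw [key, key]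
    refine sum_congr rfl fun r _ => ?_
    congr 2
    rw [prob_comp_eq_sum h (g r true) fun c => Y r c = y,
      prob_comp_eq_sum h (g r false) fun c => Y r c = y]
    simp only [hg]
  · have := key true fun _ => True
    have := key false fun _ => True
    simp_all

lemma mutualInfo_z₁_eq_zero (hP : P.Admissible) :
    mutualInfo (Outcome.law (D := D)) (fun ω => ω.z₁) (fun ω => (ω.viewA, ω.viewB₂)) = 0 := by
  rw [mutualInfo_equiv (splitBob₁ D)
    (fun a => restWeight P.p₂ D a.1 * bobWeight P.p₁ a.2) splitBob₁_law]
  refine Eq.trans ?_ (mutualInfo_announcement_eq_zero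
    (isProbWeight_restWeight hP.p₂_nonneg hP.p₂_le_one D)
    ((isProbWeight_bernWeight hP.p₁_nonneg hP.p₁_le_one).prodWeight isProbWeight_unif)
    (fun _ z v => announce₁ D z v.1 v.2) (fun _ o => prob_announce₁_bool_comm P.p₁ o)
    (fun r o =>
      -- Bob-1's components are filled with dummies: none of the expressions below reads them, and
      -- his data enters only through `o`.
      let ω : Outcome D := (splitBob₁ D).symm (r, false, fun _ => false, fun _ => Classical.arbitrary _)
      let c₁ := o.map fun s => (s.1, s.2, ω.t₁, ω.mask₁ s.1)
      let c₂ := o.bind fun s => (ω.bob₂ s.2).map fun S => (S, ω.t₂, ω.mask₂ S)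
      ((ω.m₁, ω.m₂, ω.t₁, ω.t₂, ω.x, c₁, c₂), (ω.z₂, ω.rb₂, ω.y₂, c₁, c₂))))
  congr 1
  funext a
  simp only [Outcome.viewA, Outcome.viewB₂, Outcome.c₁, Outcome.c₂, bob₁_eq_announce₁,
    bob₂_eq_announce₂]
  rfl

lemma mutualInfo_z₂_eq_zero (hP : P.Admissible) :
    mutualInfo (Outcome.law (D := D)) (fun ω => ω.z₂) (fun ω => (ω.viewA, ω.viewB₁)) = 0 := by
  rw [mutualInfo_equiv (splitBob₂ D)
    (fun a => restWeight P.p₁ D a.1 * bobWeight P.p₂ a.2) splitBob₂_law]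
  refine Eq.trans ?_ (mutualInfo_announcement_eq_zero
    (isProbWeight_restWeight hP.p₁_nonneg hP.p₁_le_one D)
    ((isProbWeight_bernWeight hP.p₂_nonneg hP.p₂_le_one).prodWeight isProbWeight_unif)
    -- Bob-1's randomness belongs to `r`, which therefore fixes `S'`; only Bob-2's announcement
    -- within `S'` remains random.
    (fun r z v => (announce₁ D r.2.2.1 r.2.2.2.2.1 r.2.2.2.2.2.2.2).bind fun s =>
      announce₂ D s.2 z v.1 v.2)
    (fun r o => ?_)
    (fun r o =>
      let ω : Outcome D := (splitBob₂ D).symm (r, false, fun _ => false, fun _ => Classical.arbitrary _)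
      let c₂ := o.map fun S => (S, ω.t₂, ω.mask₂ S)
      ((ω.m₁, ω.m₂, ω.t₁, ω.t₂, ω.x, ω.c₁, c₂), (ω.z₁, ω.rb₁, ω.y₁, ω.c₁, c₂))))
  · congr 1
    funext a
    have hc : ((splitBob₂ D).symm a).c₂ = ((announce₁ D a.1.2.2.1 a.1.2.2.2.2.1
        a.1.2.2.2.2.2.2.2).bind fun s => announce₂ D s.2 a.2.1 a.2.2.1 a.2.2.2).map
          fun S => (S, a.1.2.2.2.2.2.2.1, ((splitBob₂ D).symm a).mask₂ S) := by
      simp only [Outcome.c₂, bob₁_eq_announce₁, bob₂_eq_announce₂, Option.map_bind]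
      rfl
    simp only [Outcome.viewA, Outcome.viewB₁, Outcome.c₁, hc, bob₁_eq_announce₁]
    rfl
  · rcases announce₁ D r.2.2.1 r.2.2.2.2.1 r.2.2.2.2.2.2.2 with _ | s
    · simp
    · exact prob_announce₂_bool_comm P.p₂ s.2 o

/-- The chain rule leaves `I(Z₁;U)` and `I(Z₂;Z₁,U)`. Both vanish by data processing, as Bob-1's
view contains `Z₁`. -/
lemma mutualInfo_z₁_z₂_eq_zero (hP : P.Admissible) :
    mutualInfo (Outcome.law (D := D)) (fun ω => (ω.z₁, ω.z₂)) (fun ω => ω.viewA) = 0 := by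
  have hl := isProbWeight_law (D := D) hP
  refine le_antisymm ?_ (mutualInfo_nonneg hl.nonneg hl.sum_eq_one _ _)
  refine (mutualInfo_pair_le hl.nonneg hl.sum_eq_one _ _ _).trans ?_
  have h1 := mutualInfo_le_of_determined hl.nonneg hl.sum_eq_one (fun ω : Outcome D => ω.z₁)
    (fun ω => (ω.viewA, ω.viewB₂)) (fun ω => ω.viewA) fun ω ω' h => (Prod.mk.inj h).1
  have h2 := mutualInfo_le_of_determined hl.nonneg hl.sum_eq_one (fun ω : Outcome D => ω.z₂)
    (fun ω => (ω.viewA, ω.viewB₁)) (fun ω => (ω.z₁, ω.viewA)) fun ω ω' h => by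
      simp only [Outcome.viewB₁, Prod.mk.injEq] at h
      simp only [Prod.mk.injEq]
      exact ⟨h.2.1, h.1⟩
  rw [mutualInfo_z₁_eq_zero hP] at h1
  rw [mutualInfo_z₂_eq_zero hP] at h2
  linarith

end Protocol

/-! ### Leftover hashing applied to the protocol -/

section Security

variable {P : Params} {n : ℕ} {D : Tools P n}

/-! ### Bob-1's index sets -/

/-- Bob-1's index set with label `j`. -/
noncomputable def slotSet₁ (D : Tools P n) (j : SetRandomness D → Bool) (c : SetRandomness D) :
    Option (Finset (Fin n)) :=
  (announce₁ D c.1 c.2.2.1 c.2.2.2.2.1).map fun s => s.1 (j c)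

/-- The positions of Bob-1's index set with label `j` that Bob-2 did not receive. -/
noncomputable def hidden₁ (D : Tools P n) (j : SetRandomness D → Bool) (c : SetRandomness D) :
    Finset (Fin n) :=
  (slotSet₁ D j c).getD ∅ ∩ erasures c.2.2.2.1

/-- Bob-2's index set with label `j`. -/
noncomputable def slotSet₂ (D : Tools P n) (j : SetRandomness D → Bool) (c : SetRandomness D) :
    Option (Finset (Fin n)) :=
  (announce₁ D c.1 c.2.2.1 c.2.2.2.2.1).bind fun s =>
    (announce₂ D s.2 c.2.1 c.2.2.2.1 c.2.2.2.2.2).map fun S => S (j c)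

/-- The positions of Bob-2's index set with label `j`. -/
noncomputable def hidden₂ (D : Tools P n) (j : SetRandomness D → Bool) (c : SetRandomness D) :
    Finset (Fin n) :=
  (slotSet₂ D j c).getD ∅

/-- Everything but the channel input on `hidden₁` and Bob-1's string with label `j`, of which only
the masked form is included. -/
noncomputable def slotLeak₁ (j : SetRandomness D → Bool) (ω : Outcome D) :=
  let v := splitSlot₁ D j ω
  (v.1, slotView D.hash₁ (slotSet₁ D j v.1.1) (hidden₁ D j v.1.1) v.2)

/-- Everything but the channel input on `hidden₂` and Bob-2's string with label `j`, of which only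
the masked form is included. -/
noncomputable def slotLeak₂ (j : SetRandomness D → Bool) (ω : Outcome D) :=
  let v := splitSlot₂ D j ω
  (v.1, slotView D.hash₂ (slotSet₂ D j v.1.1) (hidden₂ D j v.1.1) v.2)

lemma restrict_congr {x x' : Fin n → Bool} {S : Finset (Fin n)} (h : ∀ l ∈ S, x l = x' l) (m : ℕ) :
    restrict x S m = restrict x' S m := by
  funext i
  by_cases hS : #S = m
  · simp only [restrict, hS, dite_true]
    exact h _ (S.orderEmbOfFin_mem hS i)
  · simp [restrict, hS]

/-- Agreement of two executions in all but one string and part of the channel input. -/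
structure AgreeOff (U : Finset (Fin n)) (ω ω' : Outcome D) : Prop where
  setRandomness : ω.setRandomness = ω'.setRandomness
  x : ∀ l ∉ U, ω.x l = ω'.x l
  c₁ : ω.c₁ = ω'.c₁
  c₂ : ω.c₂ = ω'.c₂

/-- The set randomness fixes all announcements and the slot's own masked string is part of the leak.
Every other mask reads the input only on sets disjoint from the hidden positions, so the whole
transcript can be recomputed. -/
lemma agreeOff_of_slotLeak₁ {j : SetRandomness D → Bool} {ω ω' : Outcome D}
    (h : slotLeak₁ j ω = slotLeak₁ j ω') :
    AgreeOff (hidden₁ D j ω.setRandomness) ω ω' ∧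
      ω.m₁ (!j ω.setRandomness) = ω'.m₁ (!j ω.setRandomness) ∧ ω.m₂ = ω'.m₂ := by
  simp only [slotLeak₁, splitSlot₁, slotView, Equiv.coe_fn_mk, Prod.mk.injEq] at h
  obtain ⟨⟨hc, hm, ht, hm₂, ht₂⟩, ht', hx, hS⟩ := h
  rw [← hc] at hm ht ht' hx hS
  rw [hideOn_eq_iff] at hx
  have hb : ω.bob₁ = ω'.bob₁ := by
    rw [bob₁_eq_announce₁, bob₁_eq_announce₁]
    exact congrArg (fun c : SetRandomness D => announce₁ D c.1 c.2.2.1 c.2.2.2.2.1) hc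
  have hb₂ : ∀ S', ω.bob₂ S' = ω'.bob₂ S' := fun S' => by
    rw [bob₂_eq_announce₂, bob₂_eq_announce₂]
    exact congrArg (fun c : SetRandomness D => announce₂ D S' c.2.1 c.2.2.2.1 c.2.2.2.2.2) hc
  have ht₁ : ω.t₁ = ω'.t₁ := funext (forall_bool_of (j ω.setRandomness) ht' ht)
  refine ⟨⟨hc, hx, ?_, ?_⟩, hm, hm₂⟩
  · rw [Outcome.c₁, Outcome.c₁, ← hb, ht₁]
    rcases hs : ω.bob₁ with _ | s
    · rfl
    rw [bob₁_eq_announce₁] at hs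
    have hs' : slotSet₁ D j ω.setRandomness = some (s.1 (j ω.setRandomness)) := by
      simp only [slotSet₁, Outcome.setRandomness, hs, Option.map_some]
    have hsp := announce₁_spec hs
    simp only [Option.map_some, Option.some.injEq, Prod.mk.injEq, true_and]
    refine funext (forall_bool_of (j ω.setRandomness) ?_ ?_)
    · rw [hs', Option.map_some, Option.map_some, Option.some.injEq] at hS
      exact hS
    · rw [Outcome.mask₁, Outcome.mask₁, hm, ht₁]
      congr 2
      refine restrict_congr (fun l hl => hx l fun hl' => ?_) _
      rw [hidden₁, hs', Option.getD_some, mem_inter] at hl'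
      exact disjoint_left.1 (hsp.disjoint _) hl'.1 hl
  · rw [Outcome.c₂, Outcome.c₂, ← hb, ht₂]
    rcases hs : ω.bob₁ with _ | s
    · rfl
    rw [bob₁_eq_announce₁] at hs
    have hs' : slotSet₁ D j ω.setRandomness = some (s.1 (j ω.setRandomness)) := by
      simp only [slotSet₁, Outcome.setRandomness, hs, Option.map_some]
    have hsp := announce₁_spec hs
    rw [Option.bind_some, Option.bind_some, ← hb₂]
    rcases hS₂ : ω.bob₂ s.2 with _ | S
    · rfl
    rw [bob₂_eq_announce₂] at hS₂
    simp only [Option.map_some, Option.some.injEq, Prod.mk.injEq, true_and]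
    funext b
    rw [Outcome.mask₂, Outcome.mask₂, hm₂, ht₂]
    congr 2
    refine restrict_congr (fun l hl => hx l fun hl' => ?_) _
    rw [hidden₁, hs', Option.getD_some, mem_inter] at hl'
    exact disjoint_left.1 (hsp.disjoint_fst_snd _) hl'.1 ((announce₂_spec hS₂).subset b hl)

lemma agreeOff_of_slotLeak₂ {j : SetRandomness D → Bool} {ω ω' : Outcome D}
    (h : slotLeak₂ j ω = slotLeak₂ j ω') :
    AgreeOff (hidden₂ D j ω.setRandomness) ω ω' ∧
      ω.m₂ (!j ω.setRandomness) = ω'.m₂ (!j ω.setRandomness) ∧ ω.m₁ = ω'.m₁ := by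
  simp only [slotLeak₂, splitSlot₂, slotView, Equiv.coe_fn_mk, Prod.mk.injEq] at h
  obtain ⟨⟨hc, hm, ht, hm₁, ht₁⟩, ht', hx, hS⟩ := h
  rw [← hc] at hm ht ht' hx hS
  rw [hideOn_eq_iff] at hx
  have hb : ω.bob₁ = ω'.bob₁ := by
    rw [bob₁_eq_announce₁, bob₁_eq_announce₁]
    exact congrArg (fun c : SetRandomness D => announce₁ D c.1 c.2.2.1 c.2.2.2.2.1) hc
  have hb₂ : ∀ S', ω.bob₂ S' = ω'.bob₂ S' := fun S' => by
    rw [bob₂_eq_announce₂, bob₂_eq_announce₂]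
    exact congrArg (fun c : SetRandomness D => announce₂ D S' c.2.1 c.2.2.2.1 c.2.2.2.2.2) hc
  have ht₂ : ω.t₂ = ω'.t₂ := funext (forall_bool_of (j ω.setRandomness) ht' ht)
  refine ⟨⟨hc, hx, ?_, ?_⟩, hm, hm₁⟩
  · rw [Outcome.c₁, Outcome.c₁, ← hb, ht₁]
    rcases hs : ω.bob₁ with _ | s
    · rfl
    rw [bob₁_eq_announce₁] at hs
    have hsp := announce₁_spec hs
    simp only [Option.map_some, Option.some.injEq, Prod.mk.injEq, true_and]
    funext b
    rw [Outcome.mask₁, Outcome.mask₁, hm₁, ht₁]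
    congr 2
    refine restrict_congr (fun l hl => hx l fun hl' => ?_) _
    rcases hS₂ : announce₂ D s.2 ω.z₂ ω.e₂ ω.rb₂ with _ | S
    · simp [hidden₂, slotSet₂, Outcome.setRandomness, hs, hS₂] at hl'
    · simp only [hidden₂, slotSet₂, Outcome.setRandomness, hs, hS₂, Option.bind_some,
        Option.map_some, Option.getD_some] at hl'
      exact disjoint_left.1 (hsp.disjoint_fst_snd _) hl ((announce₂_spec hS₂).subset _ hl')
  · rw [Outcome.c₂, Outcome.c₂, ← hb, ht₂]
    rcases hs : ω.bob₁ with _ | s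
    · rfl
    rw [bob₁_eq_announce₁] at hs
    rw [Option.bind_some, Option.bind_some, ← hb₂]
    rcases hS₂ : ω.bob₂ s.2 with _ | S
    · rfl
    rw [bob₂_eq_announce₂] at hS₂
    have hs' : slotSet₂ D j ω.setRandomness = some (S (j ω.setRandomness)) := by
      simp only [slotSet₂, Outcome.setRandomness, hs, hS₂, Option.map_some, Option.bind_some]
    simp only [Option.map_some, Option.some.injEq, Prod.mk.injEq, true_and]
    refine funext (forall_bool_of (j ω.setRandomness) ?_ ?_)
    · rw [hs', Option.map_some, Option.map_some, Option.some.injEq] at hS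
      exact hS
    · rw [Outcome.mask₂, Outcome.mask₂, hm, ht₂]
      congr 2
      refine restrict_congr (fun l hl => hx l fun hl' => ?_) _
      rw [hidden₂, hs', Option.getD_some] at hl'
      exact disjoint_left.1 ((announce₂_spec hS₂).disjoint _) hl' hl

/-- Beyond the transcript and his own randomness, Bob-1 sees the input only where it is not erased,
hence outside `U`. -/
lemma AgreeOff.viewB₁ {U : Finset (Fin n)} {ω ω' : Outcome D} (h : AgreeOff U ω ω')
    (hU : ∀ l ∈ U, ω.e₁ l = true) : ω.viewB₁ = ω'.viewB₁ := by
  have hc := h.setRandomness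
  simp only [Outcome.setRandomness, Prod.mk.injEq] at hc
  obtain ⟨hz₁, hz₂, he₁, he₂, hr₁, hr₂⟩ := hc
  simp only [Outcome.viewB₁, Prod.mk.injEq]
  refine ⟨hz₁, hr₁, funext fun l => ?_, h.c₁, h.c₂⟩
  rw [Outcome.y₁, Outcome.y₁, ← he₁]
  split_ifs with hl
  · rfl
  · rw [h.x l fun h' => hl (hU l h')]

lemma AgreeOff.viewB₂ {U : Finset (Fin n)} {ω ω' : Outcome D} (h : AgreeOff U ω ω')
    (hU : ∀ l ∈ U, ω.e₂ l = true) : ω.viewB₂ = ω'.viewB₂ := by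
  have hc := h.setRandomness
  simp only [Outcome.setRandomness, Prod.mk.injEq] at hc
  obtain ⟨hz₁, hz₂, he₁, he₂, hr₁, hr₂⟩ := hc
  simp only [Outcome.viewB₂, Prod.mk.injEq]
  refine ⟨hz₂, hr₂, funext fun l => ?_, h.c₁, h.c₂⟩
  rw [Outcome.y₂, Outcome.y₂, ← he₂]
  split_ifs with hl
  · rfl
  · rw [h.x l fun h' => hl (hU l h')]

lemma hidden₁_subset_e₂ (j : SetRandomness D → Bool) (ω : Outcome D) :
    ∀ l ∈ hidden₁ D j ω.setRandomness, ω.e₂ l = true := by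
  intro l hl
  exact mem_erasures.1 (mem_inter.1 hl).2

lemma hidden₁_subset_e₁ (ω : Outcome D) :
    ∀ l ∈ hidden₁ D (fun c => !c.1) ω.setRandomness, ω.e₁ l = true := by
  intro l hl
  have hl := (mem_inter.1 hl).1
  simp only [slotSet₁, Outcome.setRandomness] at hl
  rcases hs : announce₁ D ω.z₁ ω.e₁ ω.rb₁ with _ | s
  -- After an abort the default `∅` leaves no hidden position.
  · simp [hs] at hl
  · rw [hs, Option.map_some, Option.getD_some] at hl
    exact (announce₁_spec hs).bad l hl

/-- Any label works, since both of Bob-2's sets lie in `S'`, which consists of erasures of Bob-1.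
Thus Bob-1 learns neither of Bob-2's strings. -/
lemma hidden₂_subset_e₁ (j : SetRandomness D → Bool) (ω : Outcome D) :
    ∀ l ∈ hidden₂ D j ω.setRandomness, ω.e₁ l = true := by
  intro l hl
  simp only [hidden₂, slotSet₂, Outcome.setRandomness] at hl
  rcases hs : announce₁ D ω.z₁ ω.e₁ ω.rb₁ with _ | s
  · simp [hs] at hl
  rcases hS : announce₂ D s.2 ω.z₂ ω.e₂ ω.rb₂ with _ | S
  · simp [hs, hS] at hl
  · rw [hs, Option.bind_some, hS, Option.map_some, Option.getD_some] at hl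
    exact (announce₁_spec hs).left l ((announce₂_spec hS).subset _ hl)

lemma hidden₂_subset_e₂ (ω : Outcome D) :
    ∀ l ∈ hidden₂ D (fun c => !c.2.1) ω.setRandomness, ω.e₂ l = true := by
  intro l hl
  simp only [hidden₂, slotSet₂, Outcome.setRandomness] at hl
  rcases hs : announce₁ D ω.z₁ ω.e₁ ω.rb₁ with _ | s
  · simp [hs] at hl
  rcases hS : announce₂ D s.2 ω.z₂ ω.e₂ ω.rb₂ with _ | S
  · simp [hs, hS] at hl
  · rw [hs, Option.bind_some, hS, Option.map_some, Option.getD_some] at hl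
    exact (announce₂_spec hS).bad l hl

/-! ### Tail bounds for an execution -/

lemma prob_prod_fst {α β : Type*} [Fintype α] [Fintype β] (f : α → ℝ) {g : β → ℝ}
    (hg : IsProbWeight g) (A : α → Prop) :
    prob (fun v : α × β => f v.1 * g v.2) (fun v => A v.1) = prob f A := by
  classical
  rw [prob_prod, prob_eq_sum f]
  refine sum_congr rfl fun a _ => ?_
  by_cases h : A a <;> simp [h, prob, hg.sum_eq_one]

lemma prob_prod_snd {α β : Type*} [Fintype α] [Fintype β] {f : α → ℝ} (hf : IsProbWeight f)
    (g : β → ℝ) (A : β → Prop) :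
    prob (fun v : α × β => f v.1 * g v.2) (fun v => A v.2) = prob g A := by
  rw [prob_prod_swap]
  exact prob_prod_fst g hf A

lemma prob_bobWeight (p : ℝ) {T : Type*} [Fintype T] [Nonempty T] (A : (Fin n → Bool) → Prop) :
    prob (bobWeight p : Bool × (Fin n → Bool) × T → ℝ) (fun b => A b.2.1) =
      prob (bernWeight p) A :=
  (prob_prod_snd (α := Bool) isProbWeight_unif (prodWeight (bernWeight p) unif)
    fun b : (Fin n → Bool) × T => A b.1).trans (prob_prod_fst _ isProbWeight_unif A)

/-- An event about the erasures of Bob-1, given everything else but his choice bit and tapes. -/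
lemma prob_law_le_of_e₁ (hP : P.Admissible) {A : (Fin n → Bool) → Prop} {ε : ℝ}
    (h : prob (bernWeight P.p₁) A ≤ ε) : prob (Outcome.law (D := D)) (fun ω => A ω.e₁) ≤ ε := by
  rw [prob_equiv (splitBob₁ D) (fun a => restWeight P.p₂ D a.1 * bobWeight P.p₁ a.2) splitBob₁_law]
  refine (isProbWeight_restWeight hP.p₂_nonneg hP.p₂_le_one D).prob_prod_le fun r => ?_
  exact (prob_bobWeight P.p₁ A).trans_le h

/-- An event about the erasures of Bob-2, given everything else but his choice bit and tapes. -/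
lemma prob_law_le_of_e₂ (hP : P.Admissible)
    {A : Option ((Bool → Finset (Fin n)) × Finset (Fin n)) → (Fin n → Bool) → Prop} {ε : ℝ}
    (h : ∀ z e rb, prob (bernWeight P.p₂) (A (announce₁ D z e rb)) ≤ ε) :
    prob (Outcome.law (D := D)) (fun ω => A ω.bob₁ ω.e₂) ≤ ε := by
  rw [prob_equiv (splitBob₂ D) (fun a => restWeight P.p₁ D a.1 * bobWeight P.p₂ a.2) splitBob₂_law]
  refine (isProbWeight_restWeight hP.p₁_nonneg hP.p₁_le_one D).prob_prod_le fun r => ?_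
  simp only [bob₁_eq_announce₁]
  exact (prob_bobWeight P.p₂ (A (announce₁ D r.2.2.1 r.2.2.2.2.1 r.2.2.2.2.2.2.2))).trans_le
    (h _ _ _)

lemma filter_true_eq (R : Finset (Fin n)) (e : Fin n → Bool) :
    {l ∈ R | e l = true} = R ∩ erasures e := by
  ext l
  simp

lemma filter_false_eq (R : Finset (Fin n)) (e : Fin n → Bool) :
    {l ∈ R | e l = false} = R \ erasures e := by
  ext l
  simp

/-- Few positions of `R` are erased only with exponentially small probability. -/
lemma prob_card_inter_le {p : ℝ} (h0 : 0 ≤ p) (h1 : p ≤ 1) (R : Finset (Fin n)) {δ : ℝ}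
    (hδ : 0 ≤ δ) :
    prob (bernWeight p) (fun e : Fin n → Bool => (#(R ∩ erasures e) : ℝ) ≤ (p - δ) * #R) ≤
      Real.exp (-(δ ^ 2 / 2 * #R)) := by
  have := prob_card_le_exp h0 h1 R true hδ
  simpa only [filter_true_eq, bern, if_true] using this

/-- Few positions of `R` are received only with exponentially small probability. -/
lemma prob_card_sdiff_le {p : ℝ} (h0 : 0 ≤ p) (h1 : p ≤ 1) (R : Finset (Fin n)) {δ : ℝ}
    (hδ : 0 ≤ δ) :
    prob (bernWeight p) (fun e : Fin n → Bool => (#(R \ erasures e) : ℝ) ≤ (1 - p - δ) * #R) ≤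
      Real.exp (-(δ ^ 2 / 2 * #R)) := by
  have := prob_card_le_exp h0 h1 R false hδ
  simpa only [filter_false_eq, bern, if_false, Bool.false_eq_true] using this

/-! ### Secrecy of a single string -/

/-- The `-1` allows for rounding down in the size of the index set and reappears as the 1 in the
exponent. -/
lemma two_pow_div_le {k u n : ℕ} {a : ℝ} (h : k + a * n - 1 ≤ (u : ℝ)) :
    (2 : ℝ) ^ k / 2 ^ u ≤ 2 ^ (1 - a * n) := by
  rw [← Real.rpow_natCast, ← Real.rpow_natCast, ← Real.rpow_sub two_pos]
  exact Real.rpow_le_rpow_of_exponent_le one_le_two (by linarith)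

lemma k₁_le (P : Params) (n : ℕ) (h : P.lam' < P.r₁) : (P.k₁ n : ℝ) ≤ n * (P.r₁ - P.lam') :=
  Nat.floor_le (mul_nonneg n.cast_nonneg (by linarith))

lemma k₂_le (P : Params) (n : ℕ) (h : P.lam' < P.r₂) : (P.k₂ n : ℝ) ≤ n * (P.r₂ - P.lam') :=
  Nat.floor_le (mul_nonneg n.cast_nonneg (by linarith))

lemma Params.Admissible.r₁_lt_p₂ (hP : P.Admissible) : P.r₁ < P.p₂ := by
  have h1 := hP.r₁_lt
  have h2 : P.p₂ * min P.p₁ (1 - P.p₁) ≤ P.p₂ * 1 :=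
    mul_le_mul_of_nonneg_left ((min_le_left _ _).trans hP.p₁_le_one) hP.p₂_nonneg
  linarith [hP.lam_pos]

lemma Params.Admissible.p₂_sub_pos (hP : P.Admissible) : 0 < P.p₂ - P.lam' := by
  linarith [hP.r₁_lt_p₂, hP.lam'_lt_r₁]

lemma Params.Admissible.r₁_le_div (hP : P.Admissible) : P.r₁ ≤ P.r₁ / (P.p₂ - P.lam') := by
  rw [le_div_iff₀ hP.p₂_sub_pos]
  have : 0 < P.r₁ := hP.lam'_pos.trans hP.lam'_lt_r₁
  nlinarith [hP.p₂_le_one, hP.lam'_pos]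

/-- Bound for the information about one of the strings for Bob-1. -/
noncomputable def leakBound₁ (P : Params) (n : ℕ) : ℝ :=
  P.k₁ n * (2 * Real.exp (-(P.lam' ^ 2 / 2 * P.len₁ n))) + 2 ^ (1 - P.lam' * n) / Real.log 2

/-- Bound for the information about one of the strings for Bob-2. -/
noncomputable def leakBound₂ (P : Params) (n : ℕ) : ℝ := 2 ^ (1 - P.lam' * n) / Real.log 2

/-- Bob-2 received too many positions of Bob-1's set with label `j`. -/
def FewHidden₁ (D : Tools P n) (j : SetRandomness D → Bool) (c : SetRandomness D) : Prop :=
  ∃ s, slotSet₁ D j c = some s ∧ (#(s ∩ erasures c.2.2.2.1) : ℝ) ≤ (P.p₂ - P.lam') * P.len₁ n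

lemma prob_fewHidden₁_le (hP : P.Admissible) (j : SetRandomness D → Bool) :
    prob (Outcome.law (D := D)) (fun ω => FewHidden₁ D j ω.setRandomness) ≤
      2 * Real.exp (-(P.lam' ^ 2 / 2 * P.len₁ n)) := by
  have hl := isProbWeight_law (D := D) hP
  refine (prob_mono hl.nonneg
    (B := fun ω => ∃ s, ω.bob₁ = some s ∧
      ((#(s.1 true ∩ erasures ω.e₂) : ℝ) ≤ (P.p₂ - P.lam') * P.len₁ n ∨
      (#(s.1 false ∩ erasures ω.e₂) : ℝ) ≤ (P.p₂ - P.lam') * P.len₁ n)) ?_).trans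
    (prob_law_le_of_e₂ hP (D := D) (A := fun o e => ∃ s, o = some s ∧
      ((#(s.1 true ∩ erasures e) : ℝ) ≤ (P.p₂ - P.lam') * P.len₁ n ∨
      (#(s.1 false ∩ erasures e) : ℝ) ≤ (P.p₂ - P.lam') * P.len₁ n)) ?_)
  · rintro ω ⟨S, hS, h⟩
    simp only [slotSet₁, Option.map_eq_some_iff] at hS
    obtain ⟨s, hs, rfl⟩ := hS
    refine ⟨s, (bob₁_eq_announce₁ ω).trans hs, ?_⟩
    cases hj : j ω.setRandomness
    · exact Or.inr (hj ▸ h)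
    · exact Or.inl (hj ▸ h)
  · intro z e rb
    have hw := isProbWeight_bernWeight (n := n) hP.p₂_nonneg hP.p₂_le_one
    rcases hs : announce₁ D z e rb with _ | s
    · have : prob (bernWeight P.p₂) (fun _ : Fin n → Bool => False) = 0 := by simp [prob]
      simp only [reduceCtorEq, false_and, exists_false, this]
      positivity
    -- The announced sets are fixed here, so Bob-2's erasures on them are still i.i.d. A union over
    -- both labels covers a label `j` that depends on those erasures.
    · simp only [Option.some.injEq, exists_eq_left']
      refine (prob_or_le hw.nonneg _ _).trans ?_
      rw [two_mul]
      have hc := (announce₁_spec hs).card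
      have h1 := prob_card_inter_le hP.p₂_nonneg hP.p₂_le_one (s.1 true) hP.lam'_pos.le
      have h2 := prob_card_inter_le hP.p₂_nonneg hP.p₂_le_one (s.1 false) hP.lam'_pos.le
      rw [hc] at h1 h2
      exact add_le_add h1 h2

/-- Outside the rare event the hidden set is large enough for hashing; on it, at most `k₁` bits
leak. -/
lemma mutualInfo_slotLeak₁_le (hP : P.Admissible) (j : SetRandomness D → Bool) :
    mutualInfo (Outcome.law (D := D)) (fun ω => ω.m₁ (j ω.setRandomness)) (slotLeak₁ j) ≤
      leakBound₁ P n := by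
  have hw : IsProbWeight (sideWeight D : SetRandomness D × Bits (P.k₁ n) × D.hash₁.Seed ×
    (Bool → Bits (P.k₂ n)) × (Bool → D.hash₂.Seed) → ℝ) := isProbWeight_sideWeight hP D
  have key := mutualInfo_side_slotView_le hw.nonneg hw.sum_eq_one D.hash₁
    (fun a => slotSet₁ D j a.1) (fun a => hidden₁ D j a.1) (fun a s hs => ?_)
    (fun a => FewHidden₁ D j a.1) (ε := 2 ^ (1 - P.lam' * n)) (by positivity) (fun a s hs hb => ?_)
  · have e1 := mutualInfo_equiv (splitSlot₁ D j) (fun v => sideWeight D v.1 * slotWeight v.2)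
      (splitSlot₁_law j) (fun ω => (splitSlot₁ D j ω).2.1) (slotLeak₁ j)
    have e2 := prob_equiv (splitSlot₁ D j) (fun v => sideWeight D v.1 * slotWeight v.2)
      (splitSlot₁_law j) (fun ω => FewHidden₁ D j (splitSlot₁ D j ω).1.1)
    simp only [slotLeak₁, Equiv.apply_symm_apply] at e1 e2
    have e3 := prob_prod_fst (sideWeight D)
      (⟨slotWeight_nonneg, sum_slotWeight⟩ : IsProbWeight (slotWeight :
        Bits (P.k₁ n) × D.hash₁.Seed × (Fin n → Bool) → ℝ))
      (fun a : SetRandomness D × Bits (P.k₁ n) × D.hash₁.Seed ×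
        (Bool → Bits (P.k₂ n)) × (Bool → D.hash₂.Seed) => FewHidden₁ D j a.1)
    rw [← e3, ← e2] at key
    refine (e1.trans_le key).trans ?_
    rw [leakBound₁]
    gcongr
    exact prob_fewHidden₁_le hP j
  · refine ⟨?_, ?_⟩
    · rw [hidden₁, hs]
      exact inter_subset_left
    · simp only [slotSet₁, Option.map_eq_some_iff] at hs
      obtain ⟨s', hs', rfl⟩ := hs
      exact (announce₁_spec hs').card _
  · refine two_pow_div_le ?_
    have h1 : (P.p₂ - P.lam') * P.len₁ n < #(hidden₁ D j a.1) := by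
      rw [hidden₁, hs, Option.getD_some]
      by_contra h
      exact hb ⟨s, hs, not_lt.1 h⟩
    have h2 := k₁_le P n hP.lam'_lt_r₁
    have h3 : P.r₁ / (P.p₂ - P.lam') * n - 1 < P.len₁ n := Nat.sub_one_lt_floor _
    have h4 := mul_lt_mul_of_pos_left h3 hP.p₂_sub_pos
    -- The divisor `p₂ - λ'` in `ℓ₁` is chosen for this: at least about `r₁ n` positions stay
    -- hidden, and the rounding costs `p₂ - λ' ≤ 1`.
    have h5 : (P.p₂ - P.lam') * (P.r₁ / (P.p₂ - P.lam') * n - 1) =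
        P.r₁ * n - (P.p₂ - P.lam') := by
      have := hP.p₂_sub_pos.ne'
      field_simp
    have := hP.p₂_le_one
    have := hP.lam'_pos
    nlinarith

/-- All `ℓ₂` positions are hidden, so there is no bad event and no tail bound is needed. -/
lemma mutualInfo_slotLeak₂_le (hP : P.Admissible) (j : SetRandomness D → Bool) :
    mutualInfo (Outcome.law (D := D)) (fun ω => ω.m₂ (j ω.setRandomness)) (slotLeak₂ j) ≤
      leakBound₂ P n := by
  have hw : IsProbWeight (sideWeight D : SetRandomness D × Bits (P.k₂ n) × D.hash₂.Seed ×
    (Bool → Bits (P.k₁ n)) × (Bool → D.hash₁.Seed) → ℝ) := isProbWeight_sideWeight hP D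
  have hcard : ∀ c s, slotSet₂ D j c = some s → #s = P.len₂ n := fun c s hs => by
    simp only [slotSet₂, Option.bind_eq_some_iff, Option.map_eq_some_iff] at hs
    obtain ⟨s', hs', S, hS, rfl⟩ := hs
    exact (announce₂_spec hS).card _
  have key := mutualInfo_side_slotView_le hw.nonneg hw.sum_eq_one D.hash₂
    (fun a => slotSet₂ D j a.1) (fun a => hidden₂ D j a.1) (fun a s hs => ?_)
    (fun _ => False) (ε := 2 ^ (1 - P.lam' * n)) (by positivity) (fun a s hs _ => ?_)
  · have e1 := mutualInfo_equiv (splitSlot₂ D j) (fun v => sideWeight D v.1 * slotWeight v.2)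
      (splitSlot₂_law j) (fun ω => (splitSlot₂ D j ω).2.1) (slotLeak₂ j)
    simp only [slotLeak₂, Equiv.apply_symm_apply] at e1
    refine (e1.trans_le key).trans ?_
    simp [prob, leakBound₂]
  · refine ⟨?_, hcard _ _ hs⟩
    rw [hidden₂, hs]
    exact subset_rfl
  · refine two_pow_div_le ?_
    rw [hidden₂, hs, Option.getD_some, hcard _ _ hs]
    have h2 := k₂_le P n hP.lam'_lt_r₂
    have h3 : P.r₂ * n - 1 < P.len₂ n := Nat.sub_one_lt_floor _
    nlinarith

/-! ### Secrecy of the strings -/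

lemma mutualInfo_colluding_le (hP : P.Admissible) :
    mutualInfo (Outcome.law (D := D)) (fun ω => (ω.m₁ (!ω.z₁), ω.m₂ (!ω.z₂)))
      (fun ω => (ω.viewB₁, ω.viewB₂)) ≤ leakBound₁ P n + leakBound₂ P n := by
  have hl := isProbWeight_law (D := D) hP
  refine (mutualInfo_pair_le hl.nonneg hl.sum_eq_one _ _ _).trans (add_le_add ?_ ?_)
  · refine (mutualInfo_le_of_determined hl.nonneg hl.sum_eq_one _ _ _ fun ω ω' h => ?_).trans
      (mutualInfo_slotLeak₁_le (D := D) hP fun c => !c.1)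
    have h := (agreeOff_of_slotLeak₁ h).1
    rw [h.viewB₁ (hidden₁_subset_e₁ ω), h.viewB₂ (hidden₁_subset_e₂ _ ω)]
  -- This term conditions on Bob-1's unchosen string, which the leak of Bob-2's slot contains in
  -- clear.
  · refine (mutualInfo_le_of_determined hl.nonneg hl.sum_eq_one _ _ _ fun ω ω' h => ?_).trans
      (mutualInfo_slotLeak₂_le (D := D) hP fun c => !c.2.1)
    obtain ⟨h, -, hm⟩ := agreeOff_of_slotLeak₂ h
    rw [h.viewB₁ (hidden₂_subset_e₁ _ ω), h.viewB₂ (hidden₂_subset_e₂ ω), hm,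
      show ω.z₁ = ω'.z₁ from congrArg (fun c : SetRandomness D => c.1) h.setRandomness]

lemma mutualInfo_viewB₂_le (hP : P.Admissible) :
    mutualInfo (Outcome.law (D := D))
      (fun ω => (ω.m₁ false, ω.m₁ true, ω.m₂ (!ω.z₂), ω.z₁)) (fun ω => ω.viewB₂) ≤
      leakBound₁ P n + (leakBound₁ P n + (leakBound₂ P n + 0)) := by
  have hl := isProbWeight_law (D := D) hP
  refine (mutualInfo_pair_le hl.nonneg hl.sum_eq_one _ _ _).trans (add_le_add ?_
    ((mutualInfo_pair_le hl.nonneg hl.sum_eq_one _ _ _).trans (add_le_add ?_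
    ((mutualInfo_pair_le hl.nonneg hl.sum_eq_one _ _ _).trans (add_le_add ?_ ?_)))))
  · refine (mutualInfo_le_of_determined hl.nonneg hl.sum_eq_one _ _ _ fun ω ω' h => ?_).trans
      (mutualInfo_slotLeak₁_le (D := D) hP fun _ => false)
    exact (agreeOff_of_slotLeak₁ h).1.viewB₂ (hidden₁_subset_e₂ _ ω)
  · refine (mutualInfo_le_of_determined hl.nonneg hl.sum_eq_one _ _ _ fun ω ω' h => ?_).trans
      (mutualInfo_slotLeak₁_le (D := D) hP fun _ => true)
    obtain ⟨h, hm, -⟩ := agreeOff_of_slotLeak₁ h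
    rw [h.viewB₂ (hidden₁_subset_e₂ _ ω)]
    exact congrArg (·, _) hm
  · refine (mutualInfo_le_of_determined hl.nonneg hl.sum_eq_one _ _ _ fun ω ω' h => ?_).trans
      (mutualInfo_slotLeak₂_le (D := D) hP fun c => !c.2.1)
    obtain ⟨h, -, hm⟩ := agreeOff_of_slotLeak₂ h
    rw [h.viewB₂ (hidden₂_subset_e₂ ω), hm]
  -- The strings conditioned on belong to Alice's view, so perfect secrecy of the choice bit covers
  -- the last term.
  · refine (mutualInfo_le_of_determined hl.nonneg hl.sum_eq_one _ _ _ fun ω ω' h => ?_).trans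
      (mutualInfo_z₁_eq_zero (D := D) hP).le
    obtain ⟨hA, hB⟩ := Prod.mk.inj h
    simp only [Outcome.viewA, Prod.mk.injEq] at hA
    have hz : ω.z₂ = ω'.z₂ := congrArg (·.1) hB
    simp only [hA.1, hA.2.1, hB, hz]

lemma mutualInfo_viewB₁_le (hP : P.Admissible) :
    mutualInfo (Outcome.law (D := D))
      (fun ω => (ω.m₂ false, ω.m₂ true, ω.m₁ (!ω.z₁), ω.z₂)) (fun ω => ω.viewB₁) ≤
      leakBound₂ P n + (leakBound₂ P n + (leakBound₁ P n + 0)) := by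
  have hl := isProbWeight_law (D := D) hP
  refine (mutualInfo_pair_le hl.nonneg hl.sum_eq_one _ _ _).trans (add_le_add ?_
    ((mutualInfo_pair_le hl.nonneg hl.sum_eq_one _ _ _).trans (add_le_add ?_
    ((mutualInfo_pair_le hl.nonneg hl.sum_eq_one _ _ _).trans (add_le_add ?_ ?_)))))
  · refine (mutualInfo_le_of_determined hl.nonneg hl.sum_eq_one _ _ _ fun ω ω' h => ?_).trans
      (mutualInfo_slotLeak₂_le (D := D) hP fun _ => false)
    exact (agreeOff_of_slotLeak₂ h).1.viewB₁ (hidden₂_subset_e₁ _ ω)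
  · refine (mutualInfo_le_of_determined hl.nonneg hl.sum_eq_one _ _ _ fun ω ω' h => ?_).trans
      (mutualInfo_slotLeak₂_le (D := D) hP fun _ => true)
    obtain ⟨h, hm, -⟩ := agreeOff_of_slotLeak₂ h
    rw [h.viewB₁ (hidden₂_subset_e₁ _ ω)]
    exact congrArg (·, _) hm
  · refine (mutualInfo_le_of_determined hl.nonneg hl.sum_eq_one _ _ _ fun ω ω' h => ?_).trans
      (mutualInfo_slotLeak₁_le (D := D) hP fun c => !c.1)
    obtain ⟨h, -, hm⟩ := agreeOff_of_slotLeak₁ h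
    rw [h.viewB₁ (hidden₁_subset_e₁ ω), hm]
  · refine (mutualInfo_le_of_determined hl.nonneg hl.sum_eq_one _ _ _ fun ω ω' h => ?_).trans
      (mutualInfo_z₂_eq_zero (D := D) hP).le
    obtain ⟨hA, hB⟩ := Prod.mk.inj h
    simp only [Outcome.viewA, Prod.mk.injEq] at hA
    have hz : ω.z₁ = ω'.z₁ := congrArg (·.1) hB
    simp only [hA.1, hA.2.1, hB, hz]

end Security

/-! ### Exact decoding, abort probabilities and limits -/

section Correctness

variable {P : Params} {n : ℕ} {D : Tools P n}

/-- No position of `S_{z₁}` is erased, so the default of `getD` is never used there and the two hash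
values cancel. -/
lemma Outcome.est₁_eq_of_bob₁ {ω : Outcome D} {s : (Bool → Finset (Fin n)) × Finset (Fin n)}
    (hs : ω.bob₁ = some s) : ω.est₁ = some (ω.m₁ ω.z₁) := by
  have hsp := announce₁_spec ((bob₁_eq_announce₁ ω).symm.trans hs)
  simp only [Outcome.est₁, Outcome.c₁, hs, Option.map_some, Outcome.mask₁, Option.some.injEq]
  rw [restrict_congr (x := fun l => (ω.y₁ l).getD false) (x' := ω.x), bxor_bxor_right]
  intro l hl
  simp [Outcome.y₁, hsp.good l hl]

lemma Outcome.est₂_eq_of_bob₂ {ω : Outcome D} {s : (Bool → Finset (Fin n)) × Finset (Fin n)}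
    {S : Bool → Finset (Fin n)} (hs : ω.bob₁ = some s) (hS : ω.bob₂ s.2 = some S) :
    ω.est₂ = some (ω.m₂ ω.z₂) := by
  have hsp := announce₂_spec ((bob₂_eq_announce₂ ω s.2).symm.trans hS)
  simp only [Outcome.est₂, Outcome.c₂, hs, hS, Option.bind_some, Option.map_some, Outcome.mask₂,
    Option.some.injEq]
  rw [restrict_congr (x := fun l => (ω.y₂ l).getD false) (x' := ω.x), bxor_bxor_right]
  intro l hl
  simp [Outcome.y₂, hsp.good l hl]

/-- Bob-1 rarely aborts if the sets he needs are linearly smaller than those he expects. -/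
lemma prob_bob₁_none_le (hP : P.Admissible) {δ : ℝ} (hδ : 0 ≤ δ)
    (h1 : (P.len₁ n : ℝ) ≤ (1 - P.p₁ - δ) * n)
    (h2 : (P.len₁ n + P.lenLeft n : ℝ) ≤ (P.p₁ - δ) * n) :
    prob (Outcome.law (D := D)) (fun ω => ω.bob₁ = none) ≤
      2 * Real.exp (-(δ ^ 2 / 2 * n)) := by
  have hl := isProbWeight_law (D := D) hP
  have hw := isProbWeight_bernWeight (n := n) hP.p₁_nonneg hP.p₁_le_one
  refine (prob_mono hl.nonneg
    (B := fun ω => (#(univ \ erasures ω.e₁) : ℝ) ≤ (1 - P.p₁ - δ) * n ∨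
      (#(univ ∩ erasures ω.e₁) : ℝ) ≤ (P.p₁ - δ) * n) fun ω h => ?_).trans
    (prob_law_le_of_e₁ hP (D := D) (A := fun e => (#(univ \ erasures e) : ℝ) ≤
      (1 - P.p₁ - δ) * n ∨ (#(univ ∩ erasures e) : ℝ) ≤ (P.p₁ - δ) * n) ?_)
  · rw [bob₁_eq_announce₁, announce₁] at h
    simp only [ite_eq_right_iff, reduceCtorEq, imp_false, not_and_or, not_le] at h
    rw [univ_inter, ← compl_eq_univ_sdiff]
    refine h.imp (fun h => ?_) fun h => ?_
    · exact (Nat.cast_le.2 h.le).trans h1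
    · refine le_trans ?_ h2
      exact_mod_cast h.le
  · refine (prob_or_le hw.nonneg _ _).trans ?_
    have a1 := prob_card_sdiff_le (n := n) hP.p₁_nonneg hP.p₁_le_one univ hδ
    have a2 := prob_card_inter_le (n := n) hP.p₁_nonneg hP.p₁_le_one univ hδ
    rw [card_univ, Fintype.card_fin] at a1 a2
    rw [two_mul]
    exact add_le_add a1 a2

/-- Bob-2 rarely aborts if the sets he needs are linearly smaller than those he expects. -/
lemma prob_bob₂_none_le (hP : P.Admissible) {δ : ℝ} (hδ : 0 ≤ δ) (h0 : 0 < P.lenLeft n)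
    (h1 : (P.len₂ n : ℝ) ≤ (1 - P.p₂ - δ) * P.lenLeft n)
    (h2 : (P.len₂ n : ℝ) ≤ (P.p₂ - δ) * P.lenLeft n) :
    prob (Outcome.law (D := D)) (fun ω => ∃ s, ω.bob₁ = some s ∧ ω.bob₂ s.2 = none) ≤
      2 * Real.exp (-(δ ^ 2 / 2 * P.lenLeft n)) := by
  have hl := isProbWeight_law (D := D) hP
  have hw := isProbWeight_bernWeight (n := n) hP.p₂_nonneg hP.p₂_le_one
  refine (prob_mono hl.nonneg
    (B := fun ω => ∃ s, ω.bob₁ = some s ∧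
      ((#(s.2 \ erasures ω.e₂) : ℝ) ≤ (1 - P.p₂ - δ) * P.lenLeft n ∨
      (#(s.2 ∩ erasures ω.e₂) : ℝ) ≤ (P.p₂ - δ) * P.lenLeft n)) fun ω h => ?_).trans
    (prob_law_le_of_e₂ hP (D := D) (A := fun o e => ∃ s, o = some s ∧
      ((#(s.2 \ erasures e) : ℝ) ≤ (1 - P.p₂ - δ) * P.lenLeft n ∨
      (#(s.2 ∩ erasures e) : ℝ) ≤ (P.p₂ - δ) * P.lenLeft n)) ?_)
  · obtain ⟨s, hs, h⟩ := h
    refine ⟨s, hs, ?_⟩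
    have hsp := announce₁_spec ((bob₁_eq_announce₁ ω).symm.trans hs)
    have hne : s.2 ≠ ∅ := by
      rw [← card_pos.trans nonempty_iff_ne_empty, hsp.card_left]
      exact h0
    rw [bob₂_eq_announce₂, announce₂] at h
    simp only [ite_eq_right_iff, reduceCtorEq, imp_false, not_and_or, not_le, hne, ne_eq,
      not_false_eq_true, not_true_eq_false, false_or] at h
    refine h.imp (fun h => ?_) fun h => ?_
    · exact (Nat.cast_le.2 h.le).trans h1
    · exact (Nat.cast_le.2 h.le).trans h2
  · intro z e rb
    rcases hs : announce₁ D z e rb with _ | s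
    · have : prob (bernWeight P.p₂) (fun _ : Fin n → Bool => False) = 0 := by simp [prob]
      simp only [reduceCtorEq, false_and, exists_false, this]
      positivity
    · simp only [Option.some.injEq, exists_eq_left']
      refine (prob_or_le hw.nonneg _ _).trans ?_
      have a1 := prob_card_sdiff_le hP.p₂_nonneg hP.p₂_le_one s.2 hδ
      have a2 := prob_card_inter_le hP.p₂_nonneg hP.p₂_le_one s.2 hδ
      rw [(announce₁_spec hs).card_left] at a1 a2
      rw [two_mul]
      exact add_le_add a1 a2

lemma tendsto_exp_neg_mul_of_linear {c a : ℝ} (hc : 0 < c) (ha : 0 < a) {f : ℕ → ℝ}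
    (hf : ∀ n : ℕ, a * n - 1 ≤ f n) :
    Tendsto (fun n : ℕ => Real.exp (-(c * f n))) atTop (𝓝 0) := by
  have hlin : Tendsto (fun n : ℕ => a * n - 1) atTop atTop :=
    tendsto_atTop_add_const_right _ _ (tendsto_natCast_atTop_atTop.const_mul_atTop ha)
  exact Real.tendsto_exp_neg_atTop_nhds_zero.comp
    ((tendsto_atTop_mono hf hlin).const_mul_atTop hc)

lemma tendsto_mul_exp_neg_mul_of_linear {c a : ℝ} (hc : 0 < c) (ha : 0 < a) {f : ℕ → ℝ}
    (hf : ∀ n : ℕ, a * n - 1 ≤ f n) :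
    Tendsto (fun n : ℕ => n * Real.exp (-(c * f n))) atTop (𝓝 0) := by
  have h1 : Tendsto (fun n : ℕ => c * a * (n : ℝ)) atTop atTop :=
    tendsto_natCast_atTop_atTop.const_mul_atTop (mul_pos hc ha)
  have h2 := ((Real.tendsto_pow_mul_exp_neg_atTop_nhds_zero 1).comp h1).const_mul
    (Real.exp c / (c * a))
  rw [mul_zero] at h2
  refine squeeze_zero (fun n => by positivity) (fun n => ?_) h2
  -- The `-1` in the linear lower bound costs the constant factor `exp c`.
  have h3 : Real.exp (-(c * f n)) ≤ Real.exp c * Real.exp (-(c * a * n)) := by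
    rw [← Real.exp_add]
    exact Real.exp_le_exp.2 (by nlinarith [mul_le_mul_of_nonneg_left (hf n) hc.le])
  calc (n : ℝ) * Real.exp (-(c * f n)) ≤ n * (Real.exp c * Real.exp (-(c * a * n))) := by gcongr
    _ = Real.exp c / (c * a) * ((c * a * n) ^ 1 * Real.exp (-(c * a * n))) := by
      field_simp

lemma tendsto_leakBound₂ (hP : P.Admissible) : Tendsto (leakBound₂ P) atTop (𝓝 0) := by
  have h1 : Tendsto (fun n : ℕ => 1 - P.lam' * (n : ℝ)) atTop atBot :=
    tendsto_atBot_add_const_left _ _ (tendsto_neg_atTop_atBot.comp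
      (tendsto_natCast_atTop_atTop.const_mul_atTop hP.lam'_pos))
  have h2 := ((tendsto_rpow_atBot_of_base_gt_one (2 : ℝ) one_lt_two).comp h1).div_const (Real.log 2)
  rw [zero_div] at h2
  exact h2

lemma tendsto_leakBound₁ (hP : P.Admissible) : Tendsto (leakBound₁ P) atTop (𝓝 0) := by
  have hr : 0 < P.r₁ := hP.lam'_pos.trans hP.lam'_lt_r₁
  have h1 := (tendsto_mul_exp_neg_mul_of_linear (c := P.lam' ^ 2 / 2)
    (by have := hP.lam'_pos; positivity) (hr.trans_le hP.r₁_le_div)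
    (f := fun n => P.len₁ n) fun n => (Nat.sub_one_lt_floor _).le).const_mul 2
  rw [mul_zero] at h1
  have h2 : Tendsto (fun n => P.k₁ n * (2 * Real.exp (-(P.lam' ^ 2 / 2 * P.len₁ n)))) atTop
      (𝓝 0) := by
    refine squeeze_zero (fun n => by positivity) (fun n => ?_) h1
    have h3 : (P.k₁ n : ℝ) ≤ n := (k₁_le P n hP.lam'_lt_r₁).trans
      (mul_le_of_le_one_right n.cast_nonneg
        (by linarith [hP.r₁_lt_p₂, hP.p₂_le_one, hP.lam'_pos]))
    calc (P.k₁ n : ℝ) * (2 * Real.exp (-(P.lam' ^ 2 / 2 * P.len₁ n)))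
        ≤ n * (2 * Real.exp (-(P.lam' ^ 2 / 2 * P.len₁ n))) := by gcongr
      _ = 2 * (n * Real.exp (-(P.lam' ^ 2 / 2 * P.len₁ n))) := by ring
  have h4 := h2.add (tendsto_leakBound₂ hP)
  rw [add_zero] at h4
  exact h4

variable {D : ∀ n : ℕ, Tools P n}

lemma tendsto_prob_bob₁_none (hP : P.Admissible)
    (h : P.r₁ / (P.p₂ - P.lam') < min P.p₁ (1 - P.p₁)) :
    Tendsto (fun n => prob (Outcome.law (D := D n)) fun ω => ω.bob₁ = none) atTop (𝓝 0) := by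
  set ρ := P.r₁ / (P.p₂ - P.lam') with hρ
  have hρ0 : 0 ≤ ρ := div_nonneg (hP.lam'_pos.trans hP.lam'_lt_r₁).le hP.p₂_sub_pos.le
  obtain ⟨h1, h2⟩ := lt_min_iff.1 h
  -- The three bounds serve the test on received positions, the test on erased positions when there
  -- is no leftover set, and the same test with a leftover set, where `λ` is the slack.
  obtain ⟨δ, hδ0, hδ1, hδ2, hδ3⟩ : ∃ δ > 0, δ ≤ P.p₁ - ρ ∧ δ ≤ 1 - P.p₁ - ρ ∧ δ ≤ P.lam :=
    ⟨min (P.p₁ - ρ) (min (1 - P.p₁ - ρ) P.lam), lt_min (by linarith)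
      (lt_min (by linarith) hP.lam_pos), min_le_left _ _,
      (min_le_right _ _).trans (min_le_left _ _), (min_le_right _ _).trans (min_le_right _ _)⟩
  have h3 := (tendsto_exp_neg_mul_of_linear (c := δ ^ 2 / 2) (by positivity) one_pos
    (f := fun n => (n : ℝ)) fun n => by linarith).const_mul 2
  rw [mul_zero] at h3
  refine squeeze_zero (fun n => prob_nonneg (isProbWeight_law hP).nonneg _) (fun n => ?_) h3
  have hn : (0 : ℝ) ≤ n := n.cast_nonneg
  have hlen : (P.len₁ n : ℝ) ≤ ρ * n := Nat.floor_le (by positivity)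
  refine prob_bob₁_none_le hP hδ0.le ?_ ?_
  · exact hlen.trans (mul_le_mul_of_nonneg_right (by linarith) hn)
  · have hle : (P.lenLeft n : ℝ) ≤ max 0 (P.p₁ - P.lam - ρ) * n := by
      rw [Params.lenLeft]
      split_ifs
      · refine (Nat.cast_le.2 (Nat.floor_le_floor (mul_le_mul_of_nonneg_right
          (le_max_right 0 _) hn))).trans (Nat.floor_le ?_)
        exact mul_nonneg (le_max_left _ _) hn
      · rw [Nat.cast_zero]
        exact mul_nonneg (le_max_left _ _) hn
    have hmax : ρ + max 0 (P.p₁ - P.lam - ρ) ≤ P.p₁ - δ := by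
      rw [← max_add_add_left]
      exact max_le (by linarith) (by linarith)
    nlinarith [mul_le_mul_of_nonneg_right hmax hn]

lemma tendsto_prob_bob₂_none (hP : P.Admissible) (hp : 1 / 2 < P.p₁)
    (h : P.r₂ < (P.p₁ - P.lam - P.r₁ / (P.p₂ - P.lam')) * min P.p₂ (1 - P.p₂)) :
    Tendsto (fun n => prob (Outcome.law (D := D n))
      fun ω => ∃ s, ω.bob₁ = some s ∧ ω.bob₂ s.2 = none) atTop (𝓝 0) := by
  set σ := P.p₁ - P.lam - P.r₁ / (P.p₂ - P.lam') with hσ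
  set μ := min P.p₂ (1 - P.p₂) with hμ
  have hr : 0 < P.r₂ := hP.lam'_pos.trans hP.lam'_lt_r₂
  have hμ0 : 0 ≤ μ := le_min hP.p₂_nonneg (by linarith [hP.p₂_le_one])
  have hσ0 : 0 < σ := pos_of_mul_pos_left (hr.trans h) hμ0
  -- Half the gap between `μ` and `r₂ / σ`.
  obtain ⟨δ, hδ0, hδ⟩ : ∃ δ > 0, P.r₂ < σ * (μ - δ) := by
    refine ⟨(μ - P.r₂ / σ) / 2, ?_, ?_⟩
    · have : P.r₂ / σ < μ := by rwa [div_lt_iff₀ hσ0, mul_comm]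
      linarith
    · have : σ * (μ - (μ - P.r₂ / σ) / 2) = (σ * μ + P.r₂) / 2 := by
        field_simp
        ring
      linarith
  have hμδ : 0 < μ - δ := pos_of_mul_pos_right (hr.trans hδ) hσ0.le
  have hL : ∀ n : ℕ, σ * n - 1 ≤ P.lenLeft n := fun n => by
    rw [Params.lenLeft, if_pos hp]
    exact (Nat.sub_one_lt_floor _).le
  have h3 := (tendsto_exp_neg_mul_of_linear (c := δ ^ 2 / 2) (by positivity) hσ0 hL).const_mul 2
  rw [mul_zero] at h3
  -- Large `n` makes up for the rounding in `#S' ≥ σ n - 1`; the next condition makes `S'` nonempty.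
  have hlarge : ∀ᶠ n : ℕ in atTop, μ - δ ≤ (σ * (μ - δ) - P.r₂) * n :=
    (tendsto_natCast_atTop_atTop.const_mul_atTop (sub_pos.2 hδ)).eventually_ge_atTop _
  have hlarge' : ∀ᶠ n : ℕ in atTop, 2 ≤ σ * n :=
    (tendsto_natCast_atTop_atTop.const_mul_atTop hσ0).eventually_ge_atTop _
  refine squeeze_zero' (Eventually.of_forall fun n => prob_nonneg (isProbWeight_law hP).nonneg _)
    ?_ h3
  filter_upwards [hlarge, hlarge'] with n hn hn'
  have hlen : (P.len₂ n : ℝ) ≤ P.r₂ * n := Nat.floor_le (by positivity)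
  have hlen' : (P.len₂ n : ℝ) ≤ (μ - δ) * P.lenLeft n := by
    have := mul_le_mul_of_nonneg_left (hL n) hμδ.le
    nlinarith
  refine prob_bob₂_none_le hP hδ0.le ?_ ?_ ?_
  · have : (0 : ℝ) < P.lenLeft n := by linarith [hL n]
    exact_mod_cast this
  · refine hlen'.trans (mul_le_mul_of_nonneg_right ?_ (Nat.cast_nonneg _))
    linarith [min_le_right P.p₂ (1 - P.p₂)]
  · refine hlen'.trans (mul_le_mul_of_nonneg_right ?_ (Nat.cast_nonneg _))
    linarith [min_le_left P.p₂ (1 - P.p₂)]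

end Correctness
end BroadcastOT

open BroadcastOT BroadcastOT.Outcome in
theorem mainTheorem4 (P : Params) (hP : P.Admissible) (D : ∀ n : ℕ, Tools P n) :
    -- Bob-1 decodes correctly
    (P.r₁ / (P.p₂ - P.lam') < min P.p₁ (1 - P.p₁) →
      Tendsto (fun n => prob (law (D := D n)) fun ω => ω.est₁ ≠ some (ω.m₁ ω.z₁))
        atTop (𝓝 0)) ∧
    -- Bob-2 decodes correctly
    (P.r₁ / (P.p₂ - P.lam') < min P.p₁ (1 - P.p₁) → 1 / 2 < P.p₁ →
      P.r₂ < (P.p₁ - P.lam - P.r₁ / (P.p₂ - P.lam')) * min P.p₂ (1 - P.p₂) →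
      Tendsto (fun n => prob (law (D := D n)) fun ω => ω.est₂ ≠ some (ω.m₂ ω.z₂))
        atTop (𝓝 0)) ∧
    -- the unchosen strings stay hidden from the two receivers jointly
    Tendsto (fun n => mutualInfo (law (D := D n))
        (fun ω => (ω.m₁ (!ω.z₁), ω.m₂ (!ω.z₂))) (fun ω => (ω.viewB₁, ω.viewB₂)))
      atTop (𝓝 0) ∧
    -- each choice bit is perfectly hidden from Alice together with the other receiver
    (∀ n, mutualInfo (law (D := D n)) (fun ω => ω.z₁) (fun ω => (ω.viewA, ω.viewB₂)) = 0) ∧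
    (∀ n, mutualInfo (law (D := D n)) (fun ω => ω.z₂) (fun ω => (ω.viewA, ω.viewB₁)) = 0) ∧
    -- both choice bits are perfectly hidden from Alice
    (∀ n, mutualInfo (law (D := D n)) (fun ω => (ω.z₁, ω.z₂)) (fun ω => ω.viewA) = 0) ∧
    -- secrecy against the other receiver
    Tendsto (fun n => mutualInfo (law (D := D n))
        (fun ω => (ω.m₁ false, ω.m₁ true, ω.m₂ (!ω.z₂), ω.z₁)) (fun ω => ω.viewB₂))
      atTop (𝓝 0) ∧
    Tendsto (fun n => mutualInfo (law (D := D n))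
        (fun ω => (ω.m₂ false, ω.m₂ true, ω.m₁ (!ω.z₁), ω.z₂)) (fun ω => ω.viewB₁))
      atTop (𝓝 0) := by
  have hl := fun n => isProbWeight_law (D := D n) hP
  have hL₁ := tendsto_leakBound₁ hP
  have hL₂ := tendsto_leakBound₂ hP
  have hzero : Tendsto (fun _ : ℕ => (0 : ℝ)) atTop (𝓝 0) := tendsto_const_nhds
  refine ⟨fun h => ?_, fun h hp h' => ?_, ?_, fun n => mutualInfo_z₁_eq_zero hP,
    fun n => mutualInfo_z₂_eq_zero hP, fun n => mutualInfo_z₁_z₂_eq_zero hP, ?_, ?_⟩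
  · refine squeeze_zero (fun n => prob_nonneg (hl n).nonneg _)
      (fun n => prob_mono (hl n).nonneg fun ω hω => ?_) (tendsto_prob_bob₁_none (D := D) hP h)
    by_contra hne
    obtain ⟨s, hs⟩ := Option.ne_none_iff_exists'.1 hne
    exact hω (est₁_eq_of_bob₁ hs)
  · have hsum := (tendsto_prob_bob₁_none (D := D) hP h).add
      (tendsto_prob_bob₂_none (D := D) hP hp h')
    rw [add_zero] at hsum
    refine squeeze_zero (fun n => prob_nonneg (hl n).nonneg _) (fun n =>
      (prob_mono (hl n).nonneg fun ω hω => ?_).trans (prob_or_le (hl n).nonneg _ _)) hsum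
    -- Bob-2 can fail only if Bob-1 aborted, or if he himself aborted or had no second phase.
    rcases hs : ω.bob₁ with _ | s
    · exact Or.inl rfl
    · refine Or.inr ⟨s, rfl, ?_⟩
      by_contra hne
      obtain ⟨S, hS⟩ := Option.ne_none_iff_exists'.1 hne
      exact hω (est₂_eq_of_bob₂ hs hS)
  · have hsum := hL₁.add hL₂
    rw [add_zero] at hsum
    exact squeeze_zero (fun n => mutualInfo_nonneg (hl n).nonneg (hl n).sum_eq_one _ _)
      (fun n => mutualInfo_colluding_le hP) hsum
  · have hsum := hL₁.add (hL₁.add (hL₂.add hzero))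
    simp only [add_zero] at hsum
    exact squeeze_zero (fun n => mutualInfo_nonneg (hl n).nonneg (hl n).sum_eq_one _ _)
      (fun n => (mutualInfo_viewB₂_le hP).trans_eq (by ring)) hsum
  · have hsum := hL₂.add (hL₂.add (hL₁.add hzero))
    simp only [add_zero] at hsum
    exact squeeze_zero (fun n => mutualInfo_nonneg (hl n).nonneg (hl n).sum_eq_one _ _)
      (fun n => (mutualInfo_viewB₁_le hP).trans_eq (by ring)) hsum
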